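/- Let $n\ge 1$ and let $M$ be a compact, connected, $n$-dimensional smooth manifold without boundary. Let $g$ be a smooth Riemannian metric on $M$ and let $\beta$ be a smooth $1$-form on $M$ with $\|\beta\|_x<1$ for all $x\in M$, where $\|\cdot\|_x$ is the norm on $T_x^*M$ dual to $g_x$. Let $F=\sqrt g+\beta$, i.e. $F(v)=\sqrt{g(v,v)}+\beta(v)$, be the associated Randers metric. For $v\in T_xM\setminus\{0\}$ put $$g_v(u,w)=\frac12\,\frac{\partial^2}{\partial s\,\partial t}\Big|_{s=t=0}F^2(v+su+tw),\qquad \sigma_F=\sup_{x\in M}\ \sup_{v,w\in T_xM\setminus\{0\}}\frac{g_v(w,w)}{F(w)^2}\in[1,\infty]$$ (the $2$-uniform concavity constant of $F$). Let $\mathfrak m$ be the Holmes–Thompson measure of $F$, given in local coordinates by $$d\mathfrak m=\Big(\frac1{\omega_n}\int_{\{v\in\mathbb R^n:\,F(x,v)<1\}}\det\big(g_{ij}(x,v)\big)\,dv\Big)\,dx^1\cdots dx^n ,$$ where $g_{ij}(x,v)=g_v(\partial_i,\partial_j)$ and $\omega_n$ is the volume of the Euclidean unit ball of $\mathbb R^n$.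 For $p>1$ let $W^{1,p}(M)$ be the completion of $C^\infty(M)$ with respect to the $L^p$-norms (for $\mathfrak m$ and $F$) of the function and of its differential. For $f\in W^{1,p}(M)$ let $\nabla f=J^*(Df)$ be the Finsler gradient, where $J^*:T_x^*M\to T_xM$ is the Legendre transform, which sends $\alpha$ to the unique maximizer of $v\mapsto\alpha(v)-\frac12F(v)^2$ on $T_xM$. The first closed eigenvalue of the Finsler $p$-Laplacian is $$\lambda_{1,p}(M,F)=\inf\left\{\frac{\int_M F(\nabla f)^p\,d\mathfrak m}{\int_M|f|^p\,d\mathfrak m}\ :\ f\in W^{1,p}(M)\setminus\{0\},\ \int_M|f|^{p-2}f\,d\mathfrak m=0\right\}.$$ Then for all real numbers $p,q$ with $1<p\le q$, the eigenvalues $\lambda_{1,p}(M,F)$ and $\lambda_{1,q}(M,F)$ are positive, and $$\frac{p\,\lambda_{1,p}(M,F)^{1/p}}{q\,\lambda_{1,q}(M,F)^{1/q}}\ \le\ \sigma_F .$$ -/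

import Mathlib

open Set Filter Topology MeasureTheory Manifold
open scoped ContDiff ENNReal

noncomputable section

namespace Finsler

/-- The model space `ℝⁿ` with its Euclidean norm and Lebesgue measure. -/
abbrev Model (n : ℕ) : Type := EuclideanSpace ℝ (Fin n)

/-- The tangent space `T_x M` of an `n`-dimensional manifold. -/
abbrev Tan (n : ℕ) {M : Type*} [TopologicalSpace M] [ChartedSpace (Model n) M] (x : M) : Type :=
  TangentSpace (𝓡 n) x

/-- The cotangent space `T_x^* M`. -/
abbrev Cotan (n : ℕ) {M : Type*} [TopologicalSpace M] [ChartedSpace (Model n) M] (x : M) : Type :=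
  Tan n x →L[ℝ] ℝ

section Pointwise

variable {n : ℕ} {M : Type*} [TopologicalSpace M] [ChartedSpace (Model n) M]

/-- The norm `‖α‖_x = sup {α(v) : g(v, v) ≤ 1}` of a covector with respect to a Riemannian
metric `g`. -/
def coNorm [IsManifold (𝓡 n) ∞ M]
    (g : Bundle.ContMDiffRiemannianMetric (𝓡 n) ∞ (Model n) (fun x : M => Tan n x))
    (x : M) (α : Cotan n x) : ℝ :=
  sSup {r : ℝ | ∃ v : Tan n x, g.inner x v v ≤ 1 ∧ r = α v}

/-- A 1-form is smooth if it is a smooth section of the cotangent bundle. -/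
def SmoothForm [IsManifold (𝓡 n) ∞ M] (β : ∀ x : M, Cotan n x) : Prop :=
  ContMDiff (𝓡 n) ((𝓡 n).prod 𝓘(ℝ, Model n →L[ℝ] ℝ)) ∞
    (fun x : M => Bundle.TotalSpace.mk' (Model n →L[ℝ] ℝ)
      (E := fun x : M => Tan n x →L[ℝ] Bundle.Trivial M ℝ x) x (β x))

/-- The Randers metric `F = √g + β`, as a function on the tangent bundle. -/
def randers [IsManifold (𝓡 n) ∞ M]
    (g : Bundle.ContMDiffRiemannianMetric (𝓡 n) ∞ (Model n) (fun x : M => Tan n x))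
    (β : ∀ x : M, Cotan n x) (x : M) (v : Tan n x) : ℝ :=
  √(g.inner x v v) + β x v

/-- The fundamental tensor of `F`:
`g_v(u, w) = ½ ∂²/∂s∂t F²(v + s u + t w)` at `s = t = 0`. -/
def fundamentalTensor (F : ∀ x : M, Tan n x → ℝ) (x : M) (v u w : Tan n x) : ℝ :=
  (1 / 2) * deriv (fun s : ℝ => deriv (fun t : ℝ => F x (v + s • u + t • w) ^ 2) 0) 0

/-- The 2-uniform concavity constant
`σ_F = sup_x sup_{v, w ≠ 0} g_v(w, w) / F(w)²`, an element of `[0, ∞]`. -/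
def concavityConstant (F : ∀ x : M, Tan n x → ℝ) : ℝ≥0∞ :=
  ⨆ (x : M) (v : Tan n x) (w : Tan n x) (_ : v ≠ 0) (_ : w ≠ 0),
    ENNReal.ofReal (fundamentalTensor F x v w w / F x w ^ 2)

/-- The dual metric `F^*(α) = sup {α(v) : F(v) ≤ 1}` on covectors. -/
def dualMetric (F : ∀ x : M, Tan n x → ℝ) (x : M) (α : Cotan n x) : ℝ :=
  sSup {r : ℝ | ∃ v : Tan n x, F x v ≤ 1 ∧ r = α v}

/-- The Legendre transform `J^* : T_x^* M → T_x M`: the maximizer of `v ↦ α(v) - ½ F(v)²`. -/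
def legendre (F : ∀ x : M, Tan n x → ℝ) (x : M) (α : Cotan n x) : Tan n x :=
  Classical.epsilon fun v : Tan n x =>
    ∀ u : Tan n x, α u - F x u ^ 2 / 2 ≤ α v - F x v ^ 2 / 2

/-- The differential `dφ_x ∈ T_x^* M` of a real function. -/
def differential (φ : M → ℝ) (x : M) : Cotan n x :=
  mfderiv (𝓡 n) 𝓘(ℝ, ℝ) φ x

end Pointwise

section HolmesThompson

variable {n : ℕ} {M : Type*} [TopologicalSpace M] [ChartedSpace (Model n) M]

/-- The tangent vector `∑ vⁱ ∂/∂xⁱ` with components `v` at the point with coordinates `y`, for the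
coordinates given by the chart around `x₀`. -/
def coordVector (x₀ : M) (y v : Model n) : Tan n ((extChartAt (𝓡 n) x₀).symm y) :=
  mfderiv 𝓘(ℝ, Model n) (𝓡 n) (extChartAt (𝓡 n) x₀).symm y v

/-- The matrix `g_{ij}(v)` of the fundamental tensor in the chart around `x₀`. -/
def fundamentalMatrix (F : ∀ x : M, Tan n x → ℝ) (x₀ : M) (y v : Model n) :
    Matrix (Fin n) (Fin n) ℝ :=
  Matrix.of fun i j => fundamentalTensor F ((extChartAt (𝓡 n) x₀).symm y) (coordVector x₀ y v)
    (coordVector x₀ y (EuclideanSpace.single i 1)) (coordVector x₀ y (EuclideanSpace.single j 1))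

/-- The Holmes-Thompson density `(1 / ω_n) ∫_{F(v) < 1} det g_{ij}(v) dv` with respect to
`dx¹ ⋯ dxⁿ` in the chart around `x₀`, where `ω_n` is the volume of the Euclidean unit ball. -/
def holmesThompsonDensity (F : ∀ x : M, Tan n x → ℝ) (x₀ : M) (y : Model n) : ℝ≥0∞ :=
  (∫⁻ v in {v : Model n | F ((extChartAt (𝓡 n) x₀).symm y) (coordVector x₀ y v) < 1},
    ENNReal.ofReal (fundamentalMatrix F x₀ y v).det) / volume (Metric.ball (0 : Model n) 1)

/-- The Holmes-Thompson measure on the domain of the chart around `x₀`, as a measure on `M`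
which vanishes off that domain. -/
def holmesThompsonChart [MeasurableSpace M] (F : ∀ x : M, Tan n x → ℝ) (x₀ : M) : Measure M :=
  Measure.map (extChartAt (𝓡 n) x₀).symm
    ((volume.restrict (extChartAt (𝓡 n) x₀).target).withDensity (holmesThompsonDensity F x₀))

/-- The Holmes-Thompson measure of `(M, F)`. The measures given by two charts agree on the overlap
of their domains, so that their supremum in the lattice of measures is the measure on `M` which
restricts to each of them on the domain of its chart. -/
def holmesThompson [MeasurableSpace M] (F : ∀ x : M, Tan n x → ℝ) : Measure M :=
  ⨆ x₀ : M, holmesThompsonChart F x₀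

end HolmesThompson

section Eigenvalue

variable {n : ℕ} {M : Type*} [TopologicalSpace M] [ChartedSpace (Model n) M]
  [IsManifold (𝓡 n) ∞ M] [MeasurableSpace M]

/-- A (not necessarily continuous) 1-form is measurable if its values on smooth vector fields
are. -/
def MeasurableForm (m : Measure M) (η : ∀ x : M, Cotan n x) : Prop :=
  ∀ X : ContMDiffSection (𝓡 n) (Model n) ∞ (fun x : M => Tan n x),
    AEStronglyMeasurable (fun x => η x (X x)) m

/-- `f ∈ W^{1,p}(M)` with differential `η = Df`: the pair `(f, η)` is the limit of pairs
`(φ_k, dφ_k)` with `φ_k ∈ C^∞(M)`, with respect to the `L^p` norm on functions and, on 1-forms,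
the `L^p` norm given by `F^*` (in both directions, since `F^*` need not be symmetric). -/
structure IsSobolev (F : ∀ x : M, Tan n x → ℝ) (m : Measure M) (p : ℝ)
    (f : M → ℝ) (η : ∀ x : M, Cotan n x) : Prop where
  memLp : MemLp f (ENNReal.ofReal p) m
  measurable_form : MeasurableForm m η
  exists_approx : ∃ φ : ℕ → C^∞⟮𝓡 n, M; 𝓘(ℝ, ℝ), ℝ⟯,
    Tendsto (fun k => eLpNorm (fun x => φ k x - f x) (ENNReal.ofReal p) m) atTop (𝓝 0) ∧
    Tendsto (fun k => eLpNorm (fun x => dualMetric F x (differential (φ k) x - η x))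
      (ENNReal.ofReal p) m) atTop (𝓝 0) ∧
    Tendsto (fun k => eLpNorm (fun x => dualMetric F x (η x - differential (φ k) x))
      (ENNReal.ofReal p) m) atTop (𝓝 0)

/-- The energy quotient `E(f) = ∫ F(∇f)^p dm / ∫ |f|^p dm`, where `∇f = J^*(Df)` and `Df = η`. -/
def energy (F : ∀ x : M, Tan n x → ℝ) (m : Measure M) (p : ℝ)
    (f : M → ℝ) (η : ∀ x : M, Cotan n x) : ℝ :=
  (∫ x, F x (legendre F x (η x)) ^ p ∂m) / ∫ x, |f x| ^ p ∂m

/-- The first closed eigenvalue of the `p`-Laplacian of `(M, F, m)`: the infimum of `E(f)` over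
all `f ∈ W^{1,p}(M) \ {0}` with `∫ |f|^{p-2} f dm = 0`. -/
def firstEigenvalue (F : ∀ x : M, Tan n x → ℝ) (m : Measure M) (p : ℝ) : ℝ :=
  sInf {r : ℝ | ∃ (f : M → ℝ) (η : ∀ x : M, Cotan n x), IsSobolev F m p f η ∧
    ¬ (f =ᵐ[m] 0) ∧ ∫ x, |f x| ^ (p - 2) * f x ∂m = 0 ∧ r = energy F m p f η}

end Eigenvalue

end Finsler

end

/-!
The comparison holds with the constant `1` in place of `σ_F`: the quantity `p λ_{1,p}^(1/p)` is
nondecreasing in `p`. Since `g_v(v, v) = F(v)²`, taking `w = v` in the definition of `σ_F` gives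
`σ_F ≥ 1` (`one_le_concavityConstant`), and the claim follows.

The monotonicity rests on two facts about `L^p` norms.

* A function `f` with `∫ |f|^(p-2) f = 0` has minimal `L^p` norm among its translates `f - c`,
  because the constraint is the Euler equation of a convex function of `c`
  (`eLpNorm_le_eLpNorm_sub_const`). Hence an inequality `‖φ - c‖_p ≤ K ‖F^*(dφ)‖_p`, valid for each
  smooth `φ` with some `c = c(φ)`, passes to the limit and yields `λ_{1,p} ≥ K^(-p)`
  (`IsTame.rpow_neg_le_firstEigenvalue`).
* Let `p < q` and `r = q / p`. For a smooth `φ` choose `c`, by the intermediate value theorem, such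
  that `h = |φ - c|^(r-1) (φ - c)` satisfies `∫ |h|^(p-2) h = 0`. Then `|h|^p = |φ - c|^q`, while
  `dh = r |φ - c|^(r-1) dφ`, and Hölder's inequality bounds `‖F^*(dh)‖_p`. Testing `λ_{1,p}` with
  `h` gives `‖φ - c‖_q ≤ (q / p) λ_{1,p}^(-1/p) ‖F^*(dφ)‖_q` (`IsTame.exists_eLpNorm_sub_const_le`),
  and the first fact with exponent `q` turns this into `q λ_{1,q}^(1/q) ≥ p λ_{1,p}^(1/p)`.

The function `h` is a Sobolev function by the chain rule `isSobolev_comp`, which approximates a `C¹`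
function on an interval by polynomials in `C¹`. Norms of gradients are dual norms of differentials,
`F(J^*(α)) = F^*(α)` (`IsFinsler.apply_legendre`).

By the first fact, the positivity of the eigenvalues is a Poincaré inequality for smooth functions
(`exists_poincare`). It is proved in the form of a bound for the integral of `|φ(x) - φ(y)|^p` over
`M × M`: over the square of a small coordinate ball this is the classical inequality for convex
sets, and connectedness and compactness extend the bound from such squares to `M × M`
(`PairBound.of_local`).

What remains is that the Holmes-Thompson measure is finite, positive on open sets and comparable to
Lebesgue measure in small coordinate balls. This follows from the closed form of the fundamental
tensor of a Randers norm, which shows that the density is locally bounded above and away from zero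
and that it transforms correctly under changes of charts (`holmesThompson_apply`,
`holmesThompson_chartBall`). The dual norm of a measurable 1-form is measurable because it is a
supremum over countably many smooth vector fields (`exists_dense_fields`).
-/

noncomputable section

namespace Finsler

/-! ### Minkowski norms and the Legendre transform -/

section Minkowski

variable {E : Type*} [NormedAddCommGroup E] [NormedSpace ℝ E]

/-- A (not necessarily symmetric) norm: a continuous, subadditive, positively homogeneous function
which is positive off the origin. -/
structure IsMinkowski (N : E → ℝ) : Prop where
  continuous : Continuous N
  smul : ∀ (t : ℝ) (v : E), 0 ≤ t → N (t • v) = t * N v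
  add_le : ∀ v w : E, N (v + w) ≤ N v + N w
  pos : ∀ v : E, v ≠ 0 → 0 < N v

/-- The dual norm `sup {α(v) : N(v) ≤ 1}`. -/
def dualNorm (N : E → ℝ) (α : E →L[ℝ] ℝ) : ℝ :=
  sSup {r : ℝ | ∃ v : E, N v ≤ 1 ∧ r = α v}

namespace IsMinkowski

variable {N : E → ℝ}

lemma zero (hN : IsMinkowski N) : N 0 = 0 := by
  simpa using hN.smul 0 0 le_rfl

lemma nonneg (hN : IsMinkowski N) (v : E) : 0 ≤ N v := by
  rcases eq_or_ne v 0 with rfl | h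
  · exact hN.zero.ge
  · exact (hN.pos v h).le

/-- In finite dimension a Minkowski norm dominates the norm: by homogeneity it suffices to look
at the unit sphere, which is compact. -/
lemma exists_le [FiniteDimensional ℝ E] (hN : IsMinkowski N) :
    ∃ c : ℝ, 0 < c ∧ ∀ v, c * ‖v‖ ≤ N v := by
  rcases subsingleton_or_nontrivial E with h | h
  · exact ⟨1, one_pos, fun v => by rw [Subsingleton.elim v 0]; simp [hN.zero]⟩
  have : ProperSpace E := FiniteDimensional.proper ℝ E
  obtain ⟨u, hu, hmin⟩ := (isCompact_sphere (0 : E) 1).exists_isMinOn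
    (NormedSpace.sphere_nonempty.2 zero_le_one) hN.continuous.continuousOn
  have hu0 : u ≠ 0 := by
    rintro rfl; simp at hu
  refine ⟨N u, hN.pos u hu0, fun v => ?_⟩
  rcases eq_or_ne v 0 with rfl | hv
  · simp [hN.zero]
  have hv' : 0 < ‖v‖ := norm_pos_iff.2 hv
  have h1 : N u ≤ N (‖v‖⁻¹ • v) := hmin (by simp [norm_smul, hv'.ne'])
  rw [hN.smul _ _ (by positivity)] at h1
  calc N u * ‖v‖ ≤ (‖v‖⁻¹ * N v) * ‖v‖ := by gcongr
    _ = N v := by field_simp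

lemma bddAbove [FiniteDimensional ℝ E] (hN : IsMinkowski N) (α : E →L[ℝ] ℝ) :
    BddAbove {r : ℝ | ∃ v : E, N v ≤ 1 ∧ r = α v} := by
  obtain ⟨c, hc, h⟩ := hN.exists_le
  refine ⟨‖α‖ * c⁻¹, ?_⟩
  rintro r ⟨v, hv, rfl⟩
  have h1 : ‖v‖ ≤ c⁻¹ := by
    have := h v
    rw [← one_div, le_div_iff₀ hc]; linarith
  calc α v ≤ ‖α v‖ := le_abs_self _
    _ ≤ ‖α‖ * ‖v‖ := α.le_opNorm v
    _ ≤ ‖α‖ * c⁻¹ := by gcongr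

lemma apply_le_dualNorm_mul [FiniteDimensional ℝ E] (hN : IsMinkowski N) (α : E →L[ℝ] ℝ) (v : E) :
    α v ≤ dualNorm N α * N v := by
  rcases eq_or_ne v 0 with rfl | hv
  · simp [hN.zero]
  have hp := hN.pos v hv
  have h1 : α ((N v)⁻¹ • v) ≤ dualNorm N α :=
    le_csSup (hN.bddAbove α) ⟨_, by rw [hN.smul _ _ (by positivity), inv_mul_cancel₀ hp.ne'], rfl⟩
  rw [map_smul, smul_eq_mul] at h1
  calc α v = ((N v)⁻¹ * α v) * N v := by field_simp
    _ ≤ _ := by gcongr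

lemma dualNorm_le (hN : IsMinkowski N) {α : E →L[ℝ] ℝ} {C : ℝ} (hC : 0 ≤ C)
    (h : ∀ v, α v ≤ C * N v) : dualNorm N α ≤ C := by
  refine csSup_le ⟨0, 0, by simp [hN.zero], by simp⟩ ?_
  rintro r ⟨v, hv, rfl⟩
  exact (h v).trans (mul_le_of_le_one_right hC hv)

lemma dualNorm_nonneg [FiniteDimensional ℝ E] (hN : IsMinkowski N) (α : E →L[ℝ] ℝ) :
    0 ≤ dualNorm N α :=
  le_csSup (hN.bddAbove α) ⟨0, by simp [hN.zero], by simp⟩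

lemma dualNorm_add_le [FiniteDimensional ℝ E] (hN : IsMinkowski N) (α β : E →L[ℝ] ℝ) :
    dualNorm N (α + β) ≤ dualNorm N α + dualNorm N β := by
  refine hN.dualNorm_le (add_nonneg (hN.dualNorm_nonneg _) (hN.dualNorm_nonneg _)) fun v => ?_
  have := hN.apply_le_dualNorm_mul α v
  have := hN.apply_le_dualNorm_mul β v
  simp only [add_apply]; linarith

lemma dualNorm_smul [FiniteDimensional ℝ E] (hN : IsMinkowski N) {t : ℝ} (ht : 0 ≤ t)
    (α : E →L[ℝ] ℝ) : dualNorm N (t • α) = t * dualNorm N α := by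
  have key : ∀ {s : ℝ} (_ : 0 ≤ s) (γ : E →L[ℝ] ℝ), dualNorm N (s • γ) ≤ s * dualNorm N γ := by
    intro s hs γ
    refine hN.dualNorm_le (mul_nonneg hs (hN.dualNorm_nonneg _)) fun v => ?_
    have := mul_le_mul_of_nonneg_left (hN.apply_le_dualNorm_mul γ v) hs
    simpa [mul_assoc] using this
  refine le_antisymm (key ht α) ?_
  rcases ht.eq_or_lt with rfl | ht'
  · simpa using hN.dualNorm_nonneg _
  have h := key (inv_nonneg.2 ht) (t • α)
  rw [smul_smul, inv_mul_cancel₀ ht'.ne', one_smul] at h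
  calc t * dualNorm N α ≤ t * (t⁻¹ * dualNorm N (t • α)) := by gcongr
    _ = _ := by field_simp

lemma dualNorm_smul_le [FiniteDimensional ℝ E] (hN : IsMinkowski N) (t : ℝ) (α : E →L[ℝ] ℝ) :
    dualNorm N (t • α) ≤ |t| * (dualNorm N α + dualNorm N (-α)) := by
  rcases le_total 0 t with ht | ht
  · rw [hN.dualNorm_smul ht, abs_of_nonneg ht]
    gcongr
    linarith [hN.dualNorm_nonneg (-α)]
  · rw [show t • α = (-t) • (-α) by simp, hN.dualNorm_smul (neg_nonneg.2 ht), abs_of_nonpos ht]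
    refine mul_le_mul_of_nonneg_left ?_ (neg_nonneg.2 ht)
    linarith [hN.dualNorm_nonneg α]

/-- The dual norm is attained on the unit ball, by compactness. -/
lemma exists_dualNorm_eq [FiniteDimensional ℝ E] (hN : IsMinkowski N) (α : E →L[ℝ] ℝ) :
    ∃ v, N v ≤ 1 ∧ α v = dualNorm N α := by
  have : ProperSpace E := FiniteDimensional.proper ℝ E
  have hK : IsCompact {v : E | N v ≤ 1} := by
    obtain ⟨c, hc, h⟩ := hN.exists_le
    refine (isCompact_closedBall (0 : E) c⁻¹).of_isClosed_subset
      (isClosed_le hN.continuous continuous_const) fun v hv => ?_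
    rw [mem_closedBall_zero_iff, ← one_div, le_div_iff₀ hc]
    have := h v
    have hv' : N v ≤ 1 := hv
    linarith
  obtain ⟨v, hv, hmax⟩ := hK.exists_isMaxOn ⟨0, by simp [hN.zero]⟩ α.continuous.continuousOn
  refine ⟨v, hv, le_antisymm (le_csSup (hN.bddAbove α) ⟨v, hv, rfl⟩) ?_⟩
  refine csSup_le ⟨0, 0, by simp [hN.zero], by simp⟩ ?_
  rintro r ⟨w, hw, rfl⟩
  exact hmax hw

/-- Any maximizer of `u ↦ α(u) - N(u)² / 2` has norm `dualNorm N α`. -/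
lemma eq_dualNorm_of_isMax [FiniteDimensional ℝ E] (hN : IsMinkowski N) (α : E →L[ℝ] ℝ) {v : E}
    (hv : ∀ u : E, α u - N u ^ 2 / 2 ≤ α v - N v ^ 2 / 2) : N v = dualNorm N α := by
  obtain ⟨u, hu, hαu⟩ := hN.exists_dualNorm_eq α
  have h0 := hN.dualNorm_nonneg α
  have h1 := hv (dualNorm N α • u)
  rw [hN.smul _ _ h0, map_smul, smul_eq_mul, hαu] at h1
  have h2 := hN.apply_le_dualNorm_mul α v
  have h3 : (dualNorm N α * N u) ^ 2 ≤ dualNorm N α ^ 2 := by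
    rw [mul_pow]
    exact mul_le_of_le_one_right (sq_nonneg _) (pow_le_one₀ (hN.nonneg u) hu)
  have h4 : (dualNorm N α - N v) ^ 2 ≤ 0 := by nlinarith
  have h5 := pow_eq_zero_iff (two_ne_zero) |>.1 (le_antisymm h4 (sq_nonneg _))
  linarith

lemma exists_isMax [FiniteDimensional ℝ E] (hN : IsMinkowski N) (α : E →L[ℝ] ℝ) :
    ∃ v : E, ∀ u : E, α u - N u ^ 2 / 2 ≤ α v - N v ^ 2 / 2 := by
  obtain ⟨w, hw, hαw⟩ := hN.exists_dualNorm_eq α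
  have h0 := hN.dualNorm_nonneg α
  refine ⟨dualNorm N α • w, fun u => ?_⟩
  rw [hN.smul _ _ h0, map_smul, smul_eq_mul, hαw]
  have h2 := hN.apply_le_dualNorm_mul α u
  have h3 : (dualNorm N α * N w) ^ 2 ≤ dualNorm N α ^ 2 := by
    rw [mul_pow]
    exact mul_le_of_le_one_right (sq_nonneg _) (pow_le_one₀ (hN.nonneg w) hw)
  nlinarith [sq_nonneg (dualNorm N α - N u)]

end IsMinkowski

end Minkowski

section DualMetric

variable {n : ℕ} {M : Type*} [TopologicalSpace M] [ChartedSpace (Model n) M]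

/-- `F(x, ·)` is a Minkowski norm on every tangent space, which is identified with `ℝⁿ`. -/
def IsFinsler (F : ∀ x : M, Tan n x → ℝ) : Prop :=
  ∀ x : M, IsMinkowski (E := Model n) (F x)

variable {F : ∀ x : M, Tan n x → ℝ}

lemma IsFinsler.apply_le (hF : IsFinsler F) (x : M) (α : Cotan n x) (v : Tan n x) :
    α v ≤ dualMetric F x α * F x v :=
  (hF x).apply_le_dualNorm_mul α v

lemma IsFinsler.dualMetric_nonneg (hF : IsFinsler F) (x : M) (α : Cotan n x) :
    0 ≤ dualMetric F x α :=
  (hF x).dualNorm_nonneg α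

lemma IsFinsler.dualMetric_le (hF : IsFinsler F) (x : M) {α : Cotan n x} {C : ℝ} (hC : 0 ≤ C)
    (h : ∀ v : Tan n x, α v ≤ C * F x v) : dualMetric F x α ≤ C :=
  (hF x).dualNorm_le (α := α) hC h

lemma IsFinsler.dualMetric_add_le (hF : IsFinsler F) (x : M) (α β : Cotan n x) :
    dualMetric F x (α + β) ≤ dualMetric F x α + dualMetric F x β :=
  (hF x).dualNorm_add_le α β

lemma IsFinsler.dualMetric_smul (hF : IsFinsler F) (x : M) {t : ℝ} (ht : 0 ≤ t) (α : Cotan n x) :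
    dualMetric F x (t • α) = t * dualMetric F x α :=
  (hF x).dualNorm_smul ht α

lemma IsFinsler.dualMetric_smul_le (hF : IsFinsler F) (x : M) (t : ℝ) (α : Cotan n x) :
    dualMetric F x (t • α) ≤ |t| * (dualMetric F x α + dualMetric F x (-α)) :=
  (hF x).dualNorm_smul_le t α

/-- `F(J^*(α)) = F^*(α)`. -/
lemma IsFinsler.apply_legendre (hF : IsFinsler F) (x : M) (α : Cotan n x) :
    F x (legendre F x α) = dualMetric F x α :=
  (hF x).eq_dualNorm_of_isMax α (Classical.epsilon_spec ((hF x).exists_isMax α))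

end DualMetric

/-! ### The fundamental tensor of a Randers norm -/

section RandersNorm

variable {E : Type*} [NormedAddCommGroup E] [NormedSpace ℝ E]

/-- The Randers norm `√G + b` on a vector space. -/
def randersNorm (G : E →L[ℝ] E →L[ℝ] ℝ) (b : E →L[ℝ] ℝ) (v : E) : ℝ := √(G v v) + b v

/-- `G` is an inner product and the Randers norm `√G + b` is positive off the origin. -/
structure IsRanders (G : E →L[ℝ] E →L[ℝ] ℝ) (b : E →L[ℝ] ℝ) : Prop where
  symm : ∀ v w, G v w = G w v
  pos : ∀ v, v ≠ 0 → 0 < G v v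
  norm_pos : ∀ v, v ≠ 0 → 0 < randersNorm G b v

/-- The closed form of the fundamental tensor of the Randers norm `N = √G + b` at `v`:
`(N(v) / a) (G(u, w) - G(v, u) G(v, w) / a²) + dN_v(u) dN_v(w)`, where `a = √G(v, v)`. -/
def randersTensor (G : E →L[ℝ] E →L[ℝ] ℝ) (b : E →L[ℝ] ℝ) (v : E) : LinearMap.BilinForm ℝ E :=
  LinearMap.mk₂ ℝ (fun u w => randersNorm G b v / √(G v v) * (G u w - G v u * G v w / G v v)
      + (G v u / √(G v v) + b u) * (G v w / √(G v v) + b w))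
    (fun _ _ _ => by simp only [map_add, add_apply]; ring)
    (fun _ _ _ => by simp only [map_smul, smul_apply, smul_eq_mul]; ring)
    (fun _ _ _ => by simp only [map_add]; ring)
    (fun _ _ _ => by simp only [map_smul, smul_eq_mul]; ring)

variable {G : E →L[ℝ] E →L[ℝ] ℝ} {b : E →L[ℝ] ℝ}

lemma randersTensor_apply (v u w : E) :
    randersTensor G b v u w = randersNorm G b v / √(G v v) * (G u w - G v u * G v w / G v v)
      + (G v u / √(G v v) + b u) * (G v w / √(G v v) + b w) := rfl

namespace IsRanders

lemma nonneg (h : IsRanders G b) (v : E) : 0 ≤ G v v := by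
  rcases eq_or_ne v 0 with rfl | hv
  · simp
  · exact (h.pos v hv).le

/-- The Cauchy-Schwarz inequality. -/
lemma sq_le (h : IsRanders G b) (v w : E) : G v w ^ 2 ≤ G v v * G w w := by
  rcases eq_or_ne v 0 with rfl | hv
  · simp
  have hp := h.pos v hv
  have h1 := h.nonneg (w - (G v w / G v v) • v)
  simp only [map_sub, map_smul, sub_apply, smul_apply, smul_eq_mul, h.symm w v] at h1
  have h2 : G v v * (G w w - G v w / G v v * G v w -
      G v w / G v v * (G v w - G v w / G v v * G v v)) = G v v * G w w - G v w ^ 2 := by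
    field_simp; ring
  nlinarith [mul_nonneg hp.le h1]

lemma isMinkowski (h : IsRanders G b) : IsMinkowski (randersNorm G b) where
  continuous := by unfold randersNorm; fun_prop
  smul t v ht := by
    simp only [randersNorm, map_smul, smul_apply, smul_eq_mul]
    rw [← mul_assoc, Real.sqrt_mul (by positivity), Real.sqrt_mul_self ht]; ring
  add_le v w := by
    simp only [randersNorm]
    have h1 : √(G (v + w) (v + w)) ≤ √(G v v) + √(G w w) := by
      rw [Real.sqrt_le_left (by positivity)]
      have h2 : G v w ≤ √(G v v) * √(G w w) := by
        rw [← Real.sqrt_mul (h.nonneg v)]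
        exact Real.le_sqrt_of_sq_le (h.sq_le v w)
      have h3 := Real.sq_sqrt (h.nonneg v)
      have h4 := Real.sq_sqrt (h.nonneg w)
      simp only [map_add, add_apply, h.symm w v]
      nlinarith
    have := map_add b v w
    linarith
  pos := h.norm_pos

lemma hasDerivAt_line (h : IsRanders G b) {z : E} (hz : z ≠ 0) (w : E) :
    HasDerivAt (fun t : ℝ => √(G (z + t • w) (z + t • w))) (G z w / √(G z z)) 0 := by
  have h1 : HasDerivAt (fun t : ℝ => G (z + t • w) (z + t • w)) (2 * G z w) 0 := by
    have h2 : ∀ t : ℝ, G (z + t • w) (z + t • w) = G z z + t * (2 * G z w) + t ^ 2 * G w w := by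
      intro t
      simp only [map_add, map_smul, add_apply, smul_apply, smul_eq_mul, h.symm w z]; ring
    simp only [h2]
    have := (((hasDerivAt_id (0 : ℝ)).mul_const (2 * G z w)).const_add (G z z)).add
      (((hasDerivAt_id (0 : ℝ)).pow 2).mul_const (G w w))
    refine (this.congr_deriv (by simp)).congr_of_eventuallyEq (Eventually.of_forall fun t => ?_)
    simp
  have h3 := h1.sqrt (by simpa using (h.pos z hz).ne')
  refine h3.congr_deriv ?_
  simp only [zero_smul, add_zero]
  field_simp

lemma hasDerivAt_norm (h : IsRanders G b) {z : E} (hz : z ≠ 0) (w : E) :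
    HasDerivAt (fun t : ℝ => randersNorm G b (z + t • w)) (G z w / √(G z z) + b w) 0 := by
  refine (h.hasDerivAt_line hz w).add ?_
  have := ((hasDerivAt_id (0 : ℝ)).mul_const (b w)).const_add (b z)
  refine (this.congr_deriv (by simp)).congr_of_eventuallyEq (Eventually.of_forall fun t => ?_)
  simp

/-- `randersTensor` is the fundamental tensor of the Randers norm. -/
lemma deriv_deriv_sq (h : IsRanders G b) {v : E} (hv : v ≠ 0) (u w : E) :
    (1 / 2) * deriv (fun s : ℝ => deriv (fun t : ℝ =>
      randersNorm G b (v + s • u + t • w) ^ 2) 0) 0 = randersTensor G b v u w := by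
  have hne : ∀ᶠ s : ℝ in 𝓝 0, v + s • u ≠ 0 := by
    have hc : ContinuousAt (fun s : ℝ => v + s • u) 0 := by fun_prop
    exact hc.eventually_ne (by simpa using hv)
  have h1 : (fun s : ℝ => deriv (fun t : ℝ => randersNorm G b (v + s • u + t • w) ^ 2) 0) =ᶠ[𝓝 0]
      fun s => 2 * (randersNorm G b (v + s • u) *
        ((G v w + s * G u w) / √(G (v + s • u) (v + s • u)) + b w)) := by
    filter_upwards [hne] with s hs
    have := ((h.hasDerivAt_norm hs w).pow 2).deriv
    simp only [Pi.pow_def] at this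
    rw [this]
    simp only [map_add, map_smul, add_apply, smul_apply, smul_eq_mul, zero_smul, add_zero]
    push_cast; ring
  rw [h1.deriv_eq]
  have hp := Real.sqrt_pos.2 (h.pos v hv)
  have h2 : HasDerivAt (fun s : ℝ => G v w + s * G u w) (G u w) 0 := by
    simpa using ((hasDerivAt_id (0 : ℝ)).mul_const (G u w)).const_add (G v w)
  have h3 := (((h.hasDerivAt_norm hv u).mul
    ((h2.div (h.hasDerivAt_line hv u) (by simpa using hp.ne')).add_const (b w))).const_mul 2).deriv
  have h4 : √(G v v) ^ 2 = G v v := Real.sq_sqrt (h.nonneg v)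
  refine (congrArg _ h3).trans ?_
  simp only [randersTensor_apply, zero_smul, add_zero, zero_mul, Pi.div_apply]
  generalize √(G v v) = a at hp h4
  rw [← h4]
  field_simp
  ring

lemma tensor_symm (h : IsRanders G b) (v u w : E) :
    randersTensor G b v u w = randersTensor G b v w u := by
  simp only [randersTensor_apply, h.symm u w]; ring

/-- The fundamental tensor is positive definite: by Cauchy-Schwarz both of its terms are
nonnegative, and the first one vanishes only on multiples of `v`, where the second does not. -/
lemma tensor_pos (h : IsRanders G b) {v : E} (hv : v ≠ 0) {w : E} (hw : w ≠ 0) :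
    0 < randersTensor G b v w w := by
  have hp := h.pos v hv
  have ha := Real.sqrt_pos.2 hp
  have hN := h.norm_pos v hv
  rw [randersTensor_apply]
  have h1 : 0 ≤ G w w - G v w * G v w / G v v := by
    rw [sub_nonneg, div_le_iff₀ hp]
    have := h.sq_le v w
    nlinarith
  have h1' : G w w - G v w * G v w / G v v
      = G (w - (G v w / G v v) • v) (w - (G v w / G v v) • v) := by
    simp only [map_sub, map_smul, sub_apply, smul_apply, smul_eq_mul, h.symm w v]
    field_simp
    ring
  rcases eq_or_ne (w - (G v w / G v v) • v) 0 with h0 | h0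
  · have hw' : w = (G v w / G v v) • v := sub_eq_zero.1 h0
    set c := G v w / G v v
    have hc : c ≠ 0 := by
      rintro h; rw [h, zero_smul] at hw'; exact hw hw'
    have h2 : G v w / √(G v v) + b w = c * randersNorm G b v := by
      rw [hw']
      simp only [map_smul, smul_eq_mul, randersNorm]
      rw [mul_div_assoc, Real.div_sqrt]; ring
    rw [h2]
    have : 0 < (c * randersNorm G b v) * (c * randersNorm G b v) :=
      mul_self_pos.2 (mul_ne_zero hc hN.ne')
    have : 0 ≤ randersNorm G b v / √(G v v) * (G w w - G v w * G v w / G v v) := by positivity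
    linarith
  · have h3 : 0 < G w w - G v w * G v w / G v v := by rw [h1']; exact h.pos _ h0
    have : 0 < randersNorm G b v / √(G v v) * (G w w - G v w * G v w / G v v) := by positivity
    nlinarith [mul_self_nonneg (G v w / √(G v v) + b w)]

lemma tensor_self (h : IsRanders G b) {v : E} (hv : v ≠ 0) :
    randersTensor G b v v v = randersNorm G b v ^ 2 := by
  have hp := h.pos v hv
  rw [randersTensor_apply, Real.div_sqrt, mul_div_assoc, div_self hp.ne', randersNorm]
  ring

lemma tensor_smul (h : IsRanders G b) {t : ℝ} (ht : 0 < t) (v u w : E) :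
    randersTensor G b (t • v) u w = randersTensor G b v u w := by
  have h1 : √(G (t • v) (t • v)) = t * √(G v v) := by
    simp only [map_smul, smul_apply, smul_eq_mul]
    rw [← mul_assoc, Real.sqrt_mul (by positivity), Real.sqrt_mul_self ht.le]
  simp only [randersTensor_apply, h.isMinkowski.smul t v ht.le, h1]
  simp only [map_smul, smul_apply, smul_eq_mul]
  rw [mul_div_mul_left _ _ ht.ne', mul_div_mul_left _ _ ht.ne', mul_div_mul_left _ _ ht.ne']
  congr 3
  rw [show t * (t * G v v) = t ^ 2 * G v v by ring,
    show t * G v u * (t * G v w) = t ^ 2 * (G v u * G v w) by ring,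
    mul_div_mul_left _ _ (by positivity)]

end IsRanders

/-- If the dual norm of `b` with respect to `G` is less than `1`, then `√G + b` is positive off
the origin. -/
lemma isRanders_of_sSup_lt [FiniteDimensional ℝ E] (hs : ∀ v w, G v w = G w v)
    (hp : ∀ v, v ≠ 0 → 0 < G v v) (hb : sSup {r : ℝ | ∃ v, G v v ≤ 1 ∧ r = b v} < 1) :
    IsRanders G b := by
  have h0 : IsRanders G 0 :=
    ⟨hs, hp, fun v hv => by simpa [randersNorm] using hp v hv⟩
  refine ⟨hs, hp, fun v hv => ?_⟩
  have h1 : sSup {r : ℝ | ∃ v, G v v ≤ 1 ∧ r = b v} = dualNorm (randersNorm G 0) b := by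
    unfold dualNorm
    congr 1
    ext r
    simp [randersNorm]
  have h2 := h0.isMinkowski.apply_le_dualNorm_mul b (-v)
  rw [← h1] at h2
  have h3 : 0 < √(G v v) := Real.sqrt_pos.2 (hp v hv)
  have h4 : randersNorm G 0 (-v) = √(G v v) := by simp [randersNorm]
  rw [h4, map_neg] at h2
  have h5 := mul_lt_mul_of_pos_right hb h3
  rw [randersNorm]
  linarith

lemma IsRanders.tensor_self_div (h : IsRanders G b) {v : E} (hv : v ≠ 0) :
    randersTensor G b v v v / randersNorm G b v ^ 2 = 1 := by
  rw [h.tensor_self hv]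
  exact div_self (pow_pos (h.norm_pos v hv) 2).ne'

end RandersNorm

section GramDet

variable {n : ℕ} {E : Type*} [NormedAddCommGroup E] [NormedSpace ℝ E]

/-- The Gram determinant of a bilinear form on the images of the standard basis under `c`. -/
def gramDet (B : LinearMap.BilinForm ℝ E) (c : Model n →L[ℝ] E) : ℝ :=
  (Matrix.of fun i j : Fin n =>
    B (c (EuclideanSpace.single i 1)) (c (EuclideanSpace.single j 1))).det

lemma gramDet_eq (B : LinearMap.BilinForm ℝ E) (c : Model n →L[ℝ] E) :
    gramDet B c = (LinearMap.BilinForm.toMatrix (EuclideanSpace.basisFun (Fin n) ℝ).toBasis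
      (B.comp (c : Model n →ₗ[ℝ] E) (c : Model n →ₗ[ℝ] E))).det := by
  unfold gramDet
  congr 1

lemma gramDet_comp (B : LinearMap.BilinForm ℝ E) (c : Model n →L[ℝ] E)
    (L : Model n →L[ℝ] Model n) : gramDet B (c ∘L L) = L.det ^ 2 * gramDet B c := by
  have h : B.comp ((c ∘L L : Model n →L[ℝ] E) : Model n →ₗ[ℝ] E)
      ((c ∘L L : Model n →L[ℝ] E) : Model n →ₗ[ℝ] E)
      = (B.comp (c : Model n →ₗ[ℝ] E) (c : Model n →ₗ[ℝ] E)).comp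
        (L : Model n →ₗ[ℝ] Model n) (L : Model n →ₗ[ℝ] Model n) := rfl
  rw [gramDet_eq, gramDet_eq, h, LinearMap.BilinForm.toMatrix_comp
    (EuclideanSpace.basisFun (Fin n) ℝ).toBasis, Matrix.det_mul, Matrix.det_mul,
    Matrix.det_transpose, LinearMap.det_toMatrix, ContinuousLinearMap.det]
  ring

lemma gramDet_pos {B : LinearMap.BilinForm ℝ E} (hs : ∀ u w, B u w = B w u)
    (hp : ∀ w, w ≠ 0 → 0 < B w w) {c : Model n →L[ℝ] E} (hc : Function.Injective c) :
    0 < gramDet B c := by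
  refine Matrix.PosDef.det_pos (Matrix.PosDef.of_dotProduct_mulVec_pos ?_ fun x hx => ?_)
  · ext i j; simp [hs]
  · have h1 : star x ⬝ᵥ ((Matrix.of fun i j : Fin n =>
        B (c (EuclideanSpace.single i 1)) (c (EuclideanSpace.single j 1))).mulVec x)
        = B (c (WithLp.toLp 2 x)) (c (WithLp.toLp 2 x)) := by
      have h2 : (WithLp.toLp 2 x : Model n) = ∑ i, x i • EuclideanSpace.single i (1 : ℝ) := by
        ext j; simp [Finset.sum_apply, Pi.single_apply]
      rw [h2]
      simp only [map_sum, map_smul, LinearMap.sum_apply, LinearMap.smul_apply, smul_eq_mul,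
        dotProduct, Matrix.mulVec, Matrix.of_apply, Finset.mul_sum, star_trivial]
      refine (Finset.sum_comm).trans (Finset.sum_congr rfl fun i _ => Finset.sum_congr rfl
        fun j _ => ?_)
      rw [hs]; ring
    rw [h1]
    refine hp _ fun h0 => hx ?_
    have := hc (h0.trans (map_zero c).symm)
    simpa using congrArg WithLp.ofLp this

end GramDet

/-! ### Randers metrics in charts -/

section Charts

variable {n : ℕ} {M : Type*} [TopologicalSpace M] [ChartedSpace (Model n) M]
  [IsManifold (𝓡 n) ∞ M]

/-- The coordinate frame of the chart around `x₀` at the point with coordinates `y`, as a linear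
map from `ℝⁿ` to the tangent space; the latter is identified with `ℝⁿ`, so that frames at
different points can be compared. -/
def frame (x₀ : M) (y : Model n) : Model n →L[ℝ] Model n :=
  mfderiv 𝓘(ℝ, Model n) (𝓡 n) (extChartAt (𝓡 n) x₀).symm y

omit [IsManifold (𝓡 n) ∞ M] in
lemma isOpen_chart_target (x₀ : M) : IsOpen (extChartAt (𝓡 n) x₀).target :=
  isOpen_extChartAt_target x₀

lemma mdifferentiableAt_chart_symm {x₀ : M} {y : Model n}
    (hy : y ∈ (extChartAt (𝓡 n) x₀).target) :
    MDifferentiableAt 𝓘(ℝ, Model n) (𝓡 n) (extChartAt (𝓡 n) x₀).symm y :=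
  ((contMDiffOn_extChartAt_symm (n := ∞) x₀).contMDiffAt
    ((isOpen_chart_target x₀).mem_nhds hy)).mdifferentiableAt (by simp)

lemma frame_injective {x₀ : M} {y : Model n} (hy : y ∈ (extChartAt (𝓡 n) x₀).target) :
    Function.Injective (frame x₀ y) := by
  have : IsManifold (𝓡 n) 1 M := IsManifold.of_le (n := ∞) (by simp)
  have h := mfderiv_extChartAt_comp_mfderivWithin_extChartAt_symm (I := 𝓡 n) hy
  rw [(𝓡 n).range_eq_univ, mfderivWithin_univ] at h
  intro v w hvw
  have hv := congrArg (fun L => L v) h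
  have hw := congrArg (fun L => L w) h
  refine (hv.symm.trans ?_).trans hw
  exact congrArg (mfderiv (𝓡 n) 𝓘(ℝ, Model n) (extChartAt (𝓡 n) x₀)
    ((extChartAt (𝓡 n) x₀).symm y)) hvw

lemma frame_eq_symmL {x₀ x : M} (hx : x ∈ (extChartAt (𝓡 n) x₀).source) (v : Model n) :
    frame x₀ (extChartAt (𝓡 n) x₀ x) v
      = (trivializationAt (Model n) (TangentSpace (𝓡 n)) x₀).symmL ℝ x v := by
  have : IsManifold (𝓡 n) 1 M := IsManifold.of_le (n := ∞) (by simp)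
  rw [TangentBundle.symmL_trivializationAt (by simpa using hx), (𝓡 n).range_eq_univ,
    mfderivWithin_univ]
  rfl

lemma continuousOn_frame (x₀ : M) (v : Model n) :
    ContinuousOn (fun y : Model n => (⟨(extChartAt (𝓡 n) x₀).symm y, frame x₀ y v⟩ :
      TangentBundle (𝓡 n) M)) (extChartAt (𝓡 n) x₀).target := by
  set e := trivializationAt (Model n) (TangentSpace (𝓡 n) (M := M)) x₀
  have h1 : ContinuousOn (fun y : Model n =>
      e.toOpenPartialHomeomorph.symm ((extChartAt (𝓡 n) x₀).symm y, v))
      (extChartAt (𝓡 n) x₀).target := by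
    refine e.continuousOn_symm_prodMk_left.comp (continuousOn_extChartAt_symm x₀) fun y hy => ?_
    simpa [e] using (extChartAt (𝓡 n) x₀).map_target hy
  refine h1.congr fun y hy => ?_
  have hx := (extChartAt (𝓡 n) x₀).map_target hy
  have hb : (extChartAt (𝓡 n) x₀).symm y ∈ e.baseSet := by simpa [e] using hx
  have h2 := frame_eq_symmL hx v
  rw [(extChartAt (𝓡 n) x₀).right_inv hy] at h2
  rw [h2, e.symmL_apply hb]
  exact e.mk_symm hb v

/-- The pullback of a bilinear form by the coordinate frame. -/
def pullForm₂ (G : ∀ x : M, Tan n x →L[ℝ] Tan n x →L[ℝ] ℝ) (x₀ : M) (y : Model n) :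
    Model n →L[ℝ] Model n →L[ℝ] ℝ :=
  ContinuousLinearMap.bilinearComp (E := Model n) (F := Model n)
    (G ((extChartAt (𝓡 n) x₀).symm y)) (frame x₀ y) (frame x₀ y)

/-- The pullback of a covector by the coordinate frame. -/
def pullForm (β : ∀ x : M, Cotan n x) (x₀ : M) (y : Model n) : Model n →L[ℝ] ℝ :=
  (show Model n →L[ℝ] ℝ from β ((extChartAt (𝓡 n) x₀).symm y)) ∘L frame x₀ y

lemma continuousOn_pullForm₂
    (g : Bundle.ContMDiffRiemannianMetric (𝓡 n) ∞ (Model n) (fun x : M => Tan n x)) (x₀ : M) :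
    ContinuousOn (pullForm₂ g.inner x₀) (extChartAt (𝓡 n) x₀).target := by
  refine continuousOn_clm_apply.2 fun v => continuousOn_clm_apply.2 fun w => ?_
  have h := ContinuousOn.clm_bundle_apply₂ (E₃ := Bundle.Trivial M ℝ) (F₃ := ℝ)
    (s := (extChartAt (𝓡 n) x₀).target)
    (b := fun y => (extChartAt (𝓡 n) x₀).symm y)
    (g.contMDiff.continuous.comp_continuousOn (continuousOn_extChartAt_symm x₀))
    (continuousOn_frame x₀ v) (continuousOn_frame x₀ w)
  exact (Bundle.Trivial.homeomorphProd M ℝ).continuous.snd.comp_continuousOn h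

lemma continuousOn_pullForm {β : ∀ x : M, Cotan n x} (hβ : SmoothForm β) (x₀ : M) :
    ContinuousOn (pullForm β x₀) (extChartAt (𝓡 n) x₀).target := by
  refine continuousOn_clm_apply.2 fun v => ?_
  have h := ContinuousOn.clm_bundle_apply (E₂ := Bundle.Trivial M ℝ) (F₂ := ℝ)
    (s := (extChartAt (𝓡 n) x₀).target)
    (b := fun y => (extChartAt (𝓡 n) x₀).symm y)
    (hβ.continuous.comp_continuousOn (continuousOn_extChartAt_symm x₀)) (continuousOn_frame x₀ v)
  exact (Bundle.Trivial.homeomorphProd M ℝ).continuous.snd.comp_continuousOn h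

/-- The chain rule for a change of charts. -/
lemma frame_eq_comp {x₀ x₁ : M} {y : Model n} (hy : y ∈ (extChartAt (𝓡 n) x₀).target)
    (hy' : (extChartAt (𝓡 n) x₀).symm y ∈ (extChartAt (𝓡 n) x₁).source) :
    DifferentiableAt ℝ (extChartAt (𝓡 n) x₁ ∘ (extChartAt (𝓡 n) x₀).symm) y ∧
    frame x₀ y = frame x₁ (extChartAt (𝓡 n) x₁ ((extChartAt (𝓡 n) x₀).symm y)) ∘L
      fderiv ℝ (extChartAt (𝓡 n) x₁ ∘ (extChartAt (𝓡 n) x₀).symm) y := by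
  set T := extChartAt (𝓡 n) x₁ ∘ (extChartAt (𝓡 n) x₀).symm with hT
  have hsymm := mdifferentiableAt_chart_symm hy
  have hT' : MDifferentiableAt 𝓘(ℝ, Model n) 𝓘(ℝ, Model n) T y :=
    (((contMDiffOn_extChartAt (n := ∞) (I := 𝓡 n) (x := x₁)).contMDiffAt
      ((isOpen_extChartAt_source x₁).mem_nhds hy' |> fun h => by simpa using h)).mdifferentiableAt
        (by simp)).comp y hsymm
  refine ⟨hT'.differentiableAt, ?_⟩
  have hev : (extChartAt (𝓡 n) x₀).symm =ᶠ[𝓝 y] (extChartAt (𝓡 n) x₁).symm ∘ T := by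
    have h1 : ∀ᶠ z in 𝓝 y, (extChartAt (𝓡 n) x₀).symm z ∈ (extChartAt (𝓡 n) x₁).source :=
      hsymm.continuousAt.eventually_mem ((isOpen_extChartAt_source x₁).mem_nhds hy')
    filter_upwards [h1] with z hz
    simp only [hT, Function.comp_apply]
    rw [(extChartAt (𝓡 n) x₁).left_inv hz]
  have h2 : MDifferentiableAt 𝓘(ℝ, Model n) (𝓡 n) (extChartAt (𝓡 n) x₁).symm (T y) :=
    mdifferentiableAt_chart_symm ((extChartAt (𝓡 n) x₁).map_source hy')
  have h3 := mfderiv_comp y h2 hT'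
  have h4 := hev.mfderiv_eq (I := 𝓘(ℝ, Model n)) (I' := 𝓡 n)
  rw [mfderiv_eq_fderiv] at h3
  exact h4.trans h3

end Charts

section RandersMetric

variable {n : ℕ} {M : Type*} [TopologicalSpace M] [ChartedSpace (Model n) M]
  [IsManifold (𝓡 n) ∞ M]
  {g : Bundle.ContMDiffRiemannianMetric (𝓡 n) ∞ (Model n) (fun x : M => Tan n x)}
  {β : ∀ x : M, Cotan n x}

lemma isRanders_of_coNorm_lt (hβ : ∀ x : M, coNorm g x (β x) < 1) (x : M) :
    IsRanders (E := Model n) (g.inner x) (β x) :=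
  isRanders_of_sSup_lt (E := Model n) (g.symm x) (g.pos x) (hβ x)

lemma isFinsler_randers (hβ : ∀ x : M, coNorm g x (β x) < 1) : IsFinsler (randers g β) :=
  fun x => (isRanders_of_coNorm_lt hβ x).isMinkowski

lemma fundamentalTensor_randers (hβ : ∀ x : M, coNorm g x (β x) < 1) (x : M) {v : Tan n x}
    (hv : v ≠ 0) (u w : Tan n x) :
    fundamentalTensor (randers g β) x v u w
      = randersTensor (E := Model n) (g.inner x) (β x) v u w :=
  (isRanders_of_coNorm_lt hβ x).deriv_deriv_sq hv u w

/-- The 2-uniform concavity constant is at least `1`, since `g_v(v, v) = F(v)²`. -/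
lemma one_le_concavityConstant [Nonempty M] (hn : 1 ≤ n) (hβ : ∀ x : M, coNorm g x (β x) < 1) :
    1 ≤ concavityConstant (randers g β) := by
  obtain ⟨x⟩ := ‹Nonempty M›
  obtain ⟨v, hv⟩ : ∃ v : Tan n x, v ≠ 0 :=
    ⟨(EuclideanSpace.single ⟨0, hn⟩ 1 : Model n),
      (by simp : (EuclideanSpace.single ⟨0, hn⟩ 1 : Model n) ≠ 0)⟩
  have h1 : fundamentalTensor (randers g β) x v v v / randers g β x v ^ 2 = 1 :=
    (congrArg (· / randers g β x v ^ 2) (fundamentalTensor_randers hβ x hv v v)).trans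
      ((isRanders_of_coNorm_lt hβ x).tensor_self_div hv)
  calc (1 : ℝ≥0∞) = ENNReal.ofReal
        (fundamentalTensor (randers g β) x v v v / randers g β x v ^ 2) := by rw [h1]; simp
    _ ≤ _ := by
        unfold concavityConstant
        refine le_iSup_of_le x (le_iSup_of_le v (le_iSup_of_le v ?_))
        exact le_iSup₂_of_le hv hv le_rfl

lemma isRanders_pull (hβ : ∀ x : M, coNorm g x (β x) < 1) {x₀ : M} {y : Model n}
    (hy : y ∈ (extChartAt (𝓡 n) x₀).target) :
    IsRanders (pullForm₂ g.inner x₀ y) (pullForm β x₀ y) := by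
  have h := isRanders_of_coNorm_lt hβ ((extChartAt (𝓡 n) x₀).symm y)
  have hi : ∀ v, v ≠ 0 → frame x₀ y v ≠ 0 := fun v hv h0 =>
    hv (frame_injective hy (h0.trans (map_zero _).symm))
  exact ⟨fun v w => h.symm _ _, fun v hv => h.pos _ (hi v hv), fun v hv => h.norm_pos _ (hi v hv)⟩

/-- The matrix of the fundamental tensor in a chart has the Gram determinant of the closed form. -/
lemma det_fundamentalMatrix (hβ : ∀ x : M, coNorm g x (β x) < 1) {x₀ : M} {y v : Model n}
    (hy : y ∈ (extChartAt (𝓡 n) x₀).target) (hv : v ≠ 0) :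
    (fundamentalMatrix (randers g β) x₀ y v).det
      = gramDet (randersTensor (E := Model n) (g.inner ((extChartAt (𝓡 n) x₀).symm y))
        (β ((extChartAt (𝓡 n) x₀).symm y)) (frame x₀ y v)) (frame x₀ y) := by
  unfold fundamentalMatrix gramDet
  congr 2
  ext i j
  exact fundamentalTensor_randers hβ _
    (fun h0 => hv (frame_injective hy (h0.trans (map_zero _).symm))) _ _

end RandersMetric

/-! ### The Holmes-Thompson density -/

section Density

variable {n : ℕ} {E : Type*} [NormedAddCommGroup E] [NormedSpace ℝ E]

/-- The integral `∫_{N(c v) < 1} det (g_{c v}(c eᵢ, c eⱼ)) dv` for the Randers norm `N = √G + b` and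
a frame `c`. -/
def randersVolume (G : E →L[ℝ] E →L[ℝ] ℝ) (b : E →L[ℝ] ℝ) (c : Model n →L[ℝ] E) : ℝ≥0∞ :=
  ∫⁻ v in {v : Model n | randersNorm G b (c v) < 1},
    ENNReal.ofReal (gramDet (randersTensor G b (c v)) c)

lemma continuous_randersNorm (G : E →L[ℝ] E →L[ℝ] ℝ) (b : E →L[ℝ] ℝ) :
    Continuous (randersNorm G b) := by
  unfold randersNorm; fun_prop

lemma measurableSet_randersNorm_lt (G : E →L[ℝ] E →L[ℝ] ℝ) (b : E →L[ℝ] ℝ) (c : Model n →L[ℝ] E) :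
    MeasurableSet {v : Model n | randersNorm G b (c v) < 1} :=
  (isOpen_lt ((continuous_randersNorm G b).comp c.continuous) continuous_const).measurableSet

/-- Under a change of frame the Gram determinant scales by `(det L)²` and Lebesgue measure by
`|det L|⁻¹`. -/
lemma randersVolume_comp (G : E →L[ℝ] E →L[ℝ] ℝ) (b : E →L[ℝ] ℝ) (c : Model n →L[ℝ] E)
    {L : Model n →L[ℝ] Model n} (hL : Function.Injective L) :
    randersVolume G b (c ∘L L) = ENNReal.ofReal |L.det| * randersVolume G b c := by
  have hs : Function.Surjective L := LinearMap.injective_iff_surjective.1 hL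
  set f : Model n → ℝ≥0∞ := indicator {v | randersNorm G b (c v) < 1}
    fun v => ENNReal.ofReal (gramDet (randersTensor G b (c v)) c) with hf
  have h1 := lintegral_image_eq_lintegral_abs_det_fderiv_mul volume MeasurableSet.univ
    (fun x _ => (L.hasFDerivAt (x := x)).hasFDerivWithinAt) hL.injOn f
  rw [image_univ, hs.range_eq, Measure.restrict_univ] at h1
  rw [randersVolume, randersVolume, ← lintegral_indicator (measurableSet_randersNorm_lt _ _ _),
    ← lintegral_indicator (measurableSet_randersNorm_lt _ _ _), ← hf, h1,
    ← lintegral_const_mul' _ _ ENNReal.ofReal_ne_top]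
  refine lintegral_congr fun v => ?_
  by_cases hv : randersNorm G b (c (L v)) < 1
  · have e1 : ENNReal.ofReal (gramDet (randersTensor G b ((c ∘L L) v)) (c ∘L L))
        = ENNReal.ofReal |L.det| * (ENNReal.ofReal |L.det| *
          ENNReal.ofReal (gramDet (randersTensor G b (c (L v))) c)) := by
      rw [gramDet_comp, ENNReal.ofReal_mul (sq_nonneg _), ← mul_assoc,
        ← ENNReal.ofReal_mul (abs_nonneg _), abs_mul_abs_self, sq]
      rfl
    rw [indicator_of_mem (show v ∈ {v | randersNorm G b ((c ∘L L) v) < 1} from hv), e1, hf,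
      indicator_of_mem (show L v ∈ {v | randersNorm G b (c v) < 1} from hv)]
  · rw [indicator_of_notMem (show v ∉ {v | randersNorm G b ((c ∘L L) v) < 1} from hv), hf,
      indicator_of_notMem (show L v ∉ {v | randersNorm G b (c v) < 1} from hv)]
    simp

end Density

section CompactBounds

/-- A positive continuous function on a compact set is bounded, and bounded away from zero. -/
lemma exists_pos_bounds {X : Type*} [TopologicalSpace X] {K : Set X} (hK : IsCompact K)
    {f : X → ℝ} (hf : ContinuousOn f K) (hpos : ∀ x ∈ K, 0 < f x) :
    ∃ a A : ℝ, 0 < a ∧ 0 < A ∧ ∀ x ∈ K, a ≤ f x ∧ f x ≤ A := by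
  rcases K.eq_empty_or_nonempty with rfl | hne
  · exact ⟨1, 1, one_pos, one_pos, by simp⟩
  obtain ⟨x, hx, hmin⟩ := hK.exists_isMinOn hne hf
  obtain ⟨z, hz, hmax⟩ := hK.exists_isMaxOn hne hf
  exact ⟨f x, f z, hpos x hx, hpos z hz, fun y hy => ⟨hmin hy, hmax hy⟩⟩

end CompactBounds

section ChartDensity

variable {n : ℕ} {M : Type*} [TopologicalSpace M] [ChartedSpace (Model n) M]
  [IsManifold (𝓡 n) ∞ M]
  {g : Bundle.ContMDiffRiemannianMetric (𝓡 n) ∞ (Model n) (fun x : M => Tan n x)}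
  {β : ∀ x : M, Cotan n x}

/-- In the coordinates of a chart the Randers metric is comparable to the Euclidean norm, uniformly
on compact sets. -/
lemma randersNorm_pull_bounds (hβs : SmoothForm β) (hβ : ∀ x : M, coNorm g x (β x) < 1) {x₀ : M}
    {K : Set (Model n)} (hK : IsCompact K) (hKt : K ⊆ (extChartAt (𝓡 n) x₀).target) :
    ∃ r R : ℝ, 0 < r ∧ 0 < R ∧ ∀ y ∈ K, ∀ v : Model n,
      r * ‖v‖ ≤ randersNorm (pullForm₂ g.inner x₀ y) (pullForm β x₀ y) v ∧
      randersNorm (pullForm₂ g.inner x₀ y) (pullForm β x₀ y) v ≤ R * ‖v‖ := by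
  have hG := (continuousOn_pullForm₂ g x₀).mono hKt
  have hb := (continuousOn_pullForm hβs x₀).mono hKt
  have hc : ContinuousOn (fun q : Model n × Model n =>
      randersNorm (pullForm₂ g.inner x₀ q.1) (pullForm β x₀ q.1) q.2)
      (K ×ˢ Metric.sphere (0 : Model n) 1) := by
    have h1 : ContinuousOn (fun q : Model n × Model n => pullForm₂ g.inner x₀ q.1)
        (K ×ˢ Metric.sphere (0 : Model n) 1) := hG.comp continuousOn_fst fun q hq => hq.1
    have h2 : ContinuousOn (fun q : Model n × Model n => pullForm β x₀ q.1)
        (K ×ˢ Metric.sphere (0 : Model n) 1) := hb.comp continuousOn_fst fun q hq => hq.1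
    unfold randersNorm
    exact (((h1.clm_apply continuousOn_snd).clm_apply continuousOn_snd).sqrt).add
      (h2.clm_apply continuousOn_snd)
  obtain ⟨r, R, hr, hR, h⟩ := exists_pos_bounds (hK.prod (isCompact_sphere _ _)) hc
    (fun q hq => (isRanders_pull hβ (hKt hq.1)).norm_pos _ (by
      have h2 := hq.2
      rintro h0
      rw [h0] at h2
      simp at h2))
  refine ⟨r, R, hr, hR, fun y hy v => ?_⟩
  have hM := (isRanders_pull hβ (hKt hy)).isMinkowski
  rcases eq_or_ne v 0 with rfl | hv
  · simp [hM.zero]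
  have hv' : 0 < ‖v‖ := norm_pos_iff.2 hv
  have h1 := h (y, ‖v‖⁻¹ • v) ⟨hy, by simp [norm_smul, hv'.ne']⟩
  simp only [hM.smul _ v (inv_nonneg.2 hv'.le)] at h1
  rw [← div_eq_inv_mul, le_div_iff₀ hv', div_le_iff₀ hv'] at h1
  exact h1

lemma continuousOn_det_pull (hβs : SmoothForm β) (hβ : ∀ x : M, coNorm g x (β x) < 1) (x₀ : M) :
    ContinuousOn (fun q : Model n × Model n => gramDet (randersTensor (pullForm₂ g.inner x₀ q.1)
      (pullForm β x₀ q.1) q.2) (ContinuousLinearMap.id ℝ (Model n)))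
      ((extChartAt (𝓡 n) x₀).target ×ˢ {0}ᶜ) := by
  have h1 : ContinuousOn (fun q : Model n × Model n => pullForm₂ g.inner x₀ q.1)
      ((extChartAt (𝓡 n) x₀).target ×ˢ {0}ᶜ) :=
    (continuousOn_pullForm₂ g x₀).comp continuousOn_fst fun q hq => hq.1
  have h2 : ContinuousOn (fun q : Model n × Model n => pullForm β x₀ q.1)
      ((extChartAt (𝓡 n) x₀).target ×ˢ {0}ᶜ) :=
    (continuousOn_pullForm hβs x₀).comp continuousOn_fst fun q hq => hq.1
  have h3 := h1.clm_apply continuousOn_snd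
  have h4 := (h3.clm_apply continuousOn_snd)
  have hp : ∀ q ∈ (extChartAt (𝓡 n) x₀).target ×ˢ ({0}ᶜ : Set (Model n)),
      0 < pullForm₂ g.inner x₀ q.1 q.2 q.2 := fun q hq =>
    (isRanders_pull hβ hq.1).pos _ hq.2
  have hp' : ∀ q ∈ (extChartAt (𝓡 n) x₀).target ×ˢ ({0}ᶜ : Set (Model n)),
      √(pullForm₂ g.inner x₀ q.1 q.2 q.2) ≠ 0 := fun q hq => (Real.sqrt_pos.2 (hp q hq)).ne'
  unfold gramDet
  refine Continuous.comp_continuousOn (g := Matrix.det) (by fun_prop) ?_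
  refine continuousOn_pi.2 fun i => continuousOn_pi.2 fun j => ?_
  simp only [Matrix.of_apply, ContinuousLinearMap.id_apply, randersTensor_apply, randersNorm]
  have hu : ∀ u : Model n, ContinuousOn (fun q : Model n × Model n =>
      pullForm₂ g.inner x₀ q.1 q.2 u) ((extChartAt (𝓡 n) x₀).target ×ˢ {0}ᶜ) :=
    fun u => h3.clm_apply continuousOn_const
  have hbu : ∀ u : Model n, ContinuousOn (fun q : Model n × Model n =>
      pullForm β x₀ q.1 u) ((extChartAt (𝓡 n) x₀).target ×ˢ {0}ᶜ) :=
    fun u => h2.clm_apply continuousOn_const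
  exact (((h4.sqrt.add (h2.clm_apply continuousOn_snd)).div h4.sqrt hp').mul
    (((h1.clm_apply continuousOn_const).clm_apply continuousOn_const).sub
      (((hu _).mul (hu _)).div h4 fun q hq => (hp q hq).ne'))).add
    ((((hu _).div h4.sqrt hp').add (hbu _)).mul (((hu _).div h4.sqrt hp').add (hbu _)))

/-- The determinant of the fundamental tensor in a chart is bounded above and below, uniformly in
the direction and in the point of a compact set. -/
lemma det_pull_bounds (hβs : SmoothForm β) (hβ : ∀ x : M, coNorm g x (β x) < 1) {x₀ : M}
    {K : Set (Model n)} (hK : IsCompact K) (hKt : K ⊆ (extChartAt (𝓡 n) x₀).target) :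
    ∃ a A : ℝ, 0 < a ∧ 0 < A ∧ ∀ y ∈ K, ∀ v : Model n, v ≠ 0 →
      a ≤ gramDet (randersTensor (pullForm₂ g.inner x₀ y) (pullForm β x₀ y) v)
        (ContinuousLinearMap.id ℝ (Model n)) ∧
      gramDet (randersTensor (pullForm₂ g.inner x₀ y) (pullForm β x₀ y) v)
        (ContinuousLinearMap.id ℝ (Model n)) ≤ A := by
  have hne : ∀ v ∈ Metric.sphere (0 : Model n) 1, v ≠ 0 := by
    rintro v hv rfl
    simp at hv
  obtain ⟨a, A, ha, hA, h⟩ := exists_pos_bounds (hK.prod (isCompact_sphere (0 : Model n) 1))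
    ((continuousOn_det_pull hβs hβ x₀).mono (prod_mono hKt fun v hv => hne v hv))
    (fun q hq => gramDet_pos ((isRanders_pull hβ (hKt hq.1)).tensor_symm _)
      (fun w hw => (isRanders_pull hβ (hKt hq.1)).tensor_pos (hne _ hq.2) hw)
      Function.injective_id)
  refine ⟨a, A, ha, hA, fun y hy v hv => ?_⟩
  have hv' : 0 < ‖v‖ := norm_pos_iff.2 hv
  have h1 := h (y, ‖v‖⁻¹ • v) ⟨hy, by simp [norm_smul, hv'.ne']⟩
  have h2 : randersTensor (pullForm₂ g.inner x₀ y) (pullForm β x₀ y) (‖v‖⁻¹ • v)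
      = randersTensor (pullForm₂ g.inner x₀ y) (pullForm β x₀ y) v :=
    LinearMap.ext fun u => LinearMap.ext fun w =>
      (isRanders_pull hβ (hKt hy)).tensor_smul (inv_pos.2 hv') v u w
  simpa only [h2] using h1

/-- The Holmes-Thompson density in a chart, in terms of the frame of the chart. -/
lemma holmesThompsonDensity_eq (hn : 1 ≤ n) (hβ : ∀ x : M, coNorm g x (β x) < 1) {x₀ x : M}
    {y : Model n} (hy : y ∈ (extChartAt (𝓡 n) x₀).target) (hx : (extChartAt (𝓡 n) x₀).symm y = x) :
    holmesThompsonDensity (randers g β) x₀ y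
      = randersVolume (E := Model n) (g.inner x) (β x) (frame x₀ y)
        / volume (Metric.ball (0 : Model n) 1) := by
  subst hx
  have : Nontrivial (Model n) := by
    have : Nonempty (Fin n) := ⟨⟨0, hn⟩⟩
    infer_instance
  unfold holmesThompsonDensity randersVolume
  congr 1
  refine lintegral_congr_ae (ae_restrict_of_ae ?_)
  filter_upwards [compl_mem_ae_iff.2 (measure_singleton (0 : Model n))] with v hv
  rw [det_fundamentalMatrix hβ hy hv]

/-- The Holmes-Thompson density is bounded above and away from zero on compact sets of coordinates
in a chart. -/
lemma holmesThompsonDensity_bounds (hn : 1 ≤ n) (hβs : SmoothForm β)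
    (hβ : ∀ x : M, coNorm g x (β x) < 1) {x₀ : M}
    {K : Set (Model n)} (hK : IsCompact K) (hKt : K ⊆ (extChartAt (𝓡 n) x₀).target) :
    ∃ a A : ℝ≥0∞, a ≠ 0 ∧ A ≠ ⊤ ∧ ∀ y ∈ K,
      a ≤ holmesThompsonDensity (randers g β) x₀ y ∧
      holmesThompsonDensity (randers g β) x₀ y ≤ A := by
  have : Nontrivial (Model n) := by
    have : Nonempty (Fin n) := ⟨⟨0, hn⟩⟩
    infer_instance
  obtain ⟨r, R, hr, hR, hN⟩ := randersNorm_pull_bounds hβs hβ hK hKt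
  obtain ⟨a, A, ha, hA, hD⟩ := det_pull_bounds hβs hβ hK hKt
  set W := volume (Metric.ball (0 : Model n) 1)
  have hW0 : W ≠ 0 := (Metric.measure_ball_pos _ _ one_pos).ne'
  have hWt : W ≠ ⊤ := measure_ball_lt_top.ne
  refine ⟨ENNReal.ofReal a * volume (Metric.ball (0 : Model n) R⁻¹) / W,
    ENNReal.ofReal A * volume (Metric.ball (0 : Model n) r⁻¹) / W, ?_, ?_, fun y hy => ?_⟩
  · refine (ENNReal.div_pos (mul_ne_zero ?_ ?_) hWt).ne'
    · exact (ENNReal.ofReal_pos.2 ha).ne'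
    · exact (Metric.measure_ball_pos _ _ (inv_pos.2 hR)).ne'
  · exact ENNReal.div_ne_top (ENNReal.mul_ne_top ENNReal.ofReal_ne_top measure_ball_lt_top.ne) hW0
  have hm : MeasurableSet {v : Model n |
      randersNorm (pullForm₂ g.inner x₀ y) (pullForm β x₀ y) v < 1} :=
    measurableSet_randersNorm_lt _ _ (ContinuousLinearMap.id ℝ (Model n))
  rw [holmesThompsonDensity_eq hn hβ (hKt hy) rfl]
  have hvol : randersVolume (E := Model n) (g.inner ((extChartAt (𝓡 n) x₀).symm y))
      (β ((extChartAt (𝓡 n) x₀).symm y)) (frame x₀ y) = ∫⁻ v in {v : Model n |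
        randersNorm (pullForm₂ g.inner x₀ y) (pullForm β x₀ y) v < 1},
      ENNReal.ofReal (gramDet (randersTensor (pullForm₂ g.inner x₀ y) (pullForm β x₀ y) v)
        (ContinuousLinearMap.id ℝ (Model n))) := rfl
  rw [hvol]
  have h0 : ∀ᵐ v : Model n, v ≠ 0 := compl_mem_ae_iff.2 (measure_singleton (0 : Model n))
  constructor
  · gcongr
    calc ENNReal.ofReal a * volume (Metric.ball (0 : Model n) R⁻¹)
        ≤ ENNReal.ofReal a * volume {v : Model n |
          randersNorm (pullForm₂ g.inner x₀ y) (pullForm β x₀ y) v < 1} := by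
          gcongr
          intro v hv
          rw [mem_ball_zero_iff, ← one_div, lt_div_iff₀ hR] at hv
          exact (hN y hy v).2.trans_lt (by linarith)
      _ = ∫⁻ v in {v : Model n |
        randersNorm (pullForm₂ g.inner x₀ y) (pullForm β x₀ y) v < 1}, ENNReal.ofReal a := by
          simp
      _ ≤ _ := by
          refine lintegral_mono_ae (ae_restrict_of_ae ?_)
          filter_upwards [h0] with v hv
          exact ENNReal.ofReal_le_ofReal (hD y hy v hv).1
  · gcongr
    calc _ ≤ ∫⁻ v in {v : Model n |
        randersNorm (pullForm₂ g.inner x₀ y) (pullForm β x₀ y) v < 1}, ENNReal.ofReal A := by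
          refine lintegral_mono_ae (ae_restrict_of_ae ?_)
          filter_upwards [h0] with v hv
          exact ENNReal.ofReal_le_ofReal (hD y hy v hv).2
      _ = ENNReal.ofReal A * volume {v : Model n |
          randersNorm (pullForm₂ g.inner x₀ y) (pullForm β x₀ y) v < 1} := by simp
      _ ≤ _ := by
          gcongr
          intro v hv
          rw [mem_ball_zero_iff, ← one_div, lt_div_iff₀ hr]
          have := (hN y hy v).1
          have hv' : randersNorm (pullForm₂ g.inner x₀ y) (pullForm β x₀ y) v < 1 := hv
          linarith

/-- The Holmes-Thompson density transforms like a density under a change of charts. -/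
lemma holmesThompsonDensity_change (hn : 1 ≤ n) (hβ : ∀ x : M, coNorm g x (β x) < 1) {x₀ x₁ : M}
    {y : Model n} (hy : y ∈ (extChartAt (𝓡 n) x₀).target)
    (hy' : (extChartAt (𝓡 n) x₀).symm y ∈ (extChartAt (𝓡 n) x₁).source) :
    holmesThompsonDensity (randers g β) x₀ y
      = ENNReal.ofReal
          |(fderiv ℝ (extChartAt (𝓡 n) x₁ ∘ (extChartAt (𝓡 n) x₀).symm) y).det| *
        holmesThompsonDensity (randers g β) x₁
          ((extChartAt (𝓡 n) x₁ ∘ (extChartAt (𝓡 n) x₀).symm) y) := by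
  have h1 := (frame_eq_comp hy hy').2
  have hinj := frame_injective hy
  rw [h1] at hinj
  have h2 := holmesThompsonDensity_eq hn hβ ((extChartAt (𝓡 n) x₁).map_source hy')
    ((extChartAt (𝓡 n) x₁).left_inv hy')
  have h3 := holmesThompsonDensity_eq hn hβ hy rfl
  rw [h1] at h3
  have h4 := randersVolume_comp (E := Model n) (g.inner ((extChartAt (𝓡 n) x₀).symm y))
    (β ((extChartAt (𝓡 n) x₀).symm y))
    (frame x₁ (extChartAt (𝓡 n) x₁ ((extChartAt (𝓡 n) x₀).symm y)))
    (L := fderiv ℝ (extChartAt (𝓡 n) x₁ ∘ (extChartAt (𝓡 n) x₀).symm) y)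
    (fun v w hvw => hinj (congrArg
      (frame x₁ (extChartAt (𝓡 n) x₁ ((extChartAt (𝓡 n) x₀).symm y))) hvw))
  rw [h3, Function.comp_apply, h2, ← mul_div_assoc]
  exact congrArg (· / volume (Metric.ball (0 : Model n) 1)) h4

end ChartDensity

/-! ### The Holmes-Thompson measure -/

section Measure

variable {n : ℕ} {M : Type*} [TopologicalSpace M] [ChartedSpace (Model n) M]
  [MeasurableSpace M] [BorelSpace M]

omit [MeasurableSpace M] [BorelSpace M] in
lemma mapsTo_chart_symm (x₀ : M) : MapsTo (extChartAt (𝓡 n) x₀).symm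
    (extChartAt (𝓡 n) x₀).target (extChartAt (𝓡 n) x₀).source :=
  fun _ hy => (extChartAt (𝓡 n) x₀).map_target hy

lemma aemeasurable_chart_symm (x₀ : M) : AEMeasurable (extChartAt (𝓡 n) x₀).symm
    (volume.restrict (extChartAt (𝓡 n) x₀).target) :=
  (continuousOn_extChartAt_symm x₀).aemeasurable (isOpen_chart_target x₀).measurableSet

lemma measurableSet_chart_preimage (x₀ : M) {B : Set M} (hB : MeasurableSet B) :
    MeasurableSet ((extChartAt (𝓡 n) x₀).symm ⁻¹' B ∩ (extChartAt (𝓡 n) x₀).target) := by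
  have h1 : Measurable ((extChartAt (𝓡 n) x₀).target.domRestrict (extChartAt (𝓡 n) x₀).symm) :=
    (continuousOn_iff_continuous_domRestrict.1 (continuousOn_extChartAt_symm x₀)).measurable
  have h2 := (isOpen_chart_target x₀).measurableSet.subtype_image (h1 hB)
  convert h2 using 1
  ext y
  constructor
  · rintro ⟨hy, hyt⟩
    exact ⟨⟨y, hyt⟩, hy, rfl⟩
  · rintro ⟨⟨z, hz⟩, h, rfl⟩
    exact ⟨h, hz⟩

/-- The measure of a set in the domain of a chart is the integral of the density. -/
lemma holmesThompsonChart_apply (F : ∀ x : M, Tan n x → ℝ) (x₀ : M) {B : Set M}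
    (hB : MeasurableSet B) :
    holmesThompsonChart F x₀ B
      = ∫⁻ y in (extChartAt (𝓡 n) x₀).symm ⁻¹' B ∩ (extChartAt (𝓡 n) x₀).target,
          holmesThompsonDensity F x₀ y := by
  unfold holmesThompsonChart
  rw [Measure.map_apply_of_aemeasurable
    ((aemeasurable_chart_symm x₀).mono_ac (withDensity_absolutelyContinuous _ _)) hB,
    withDensity_apply', Measure.restrict_restrict' (isOpen_chart_target x₀).measurableSet]

variable [IsManifold (𝓡 n) ∞ M]
  {g : Bundle.ContMDiffRiemannianMetric (𝓡 n) ∞ (Model n) (fun x : M => Tan n x)}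
  {β : ∀ x : M, Cotan n x}

/-- The measures given by two charts agree on the overlap of their domains. -/
lemma holmesThompsonChart_eq (hn : 1 ≤ n) (hβ : ∀ x : M, coNorm g x (β x) < 1) {x₀ x₁ : M}
    {B : Set M} (hB : MeasurableSet B) (h0 : B ⊆ (extChartAt (𝓡 n) x₀).source)
    (h1 : B ⊆ (extChartAt (𝓡 n) x₁).source) :
    holmesThompsonChart (randers g β) x₁ B = holmesThompsonChart (randers g β) x₀ B := by
  set e₀ := extChartAt (𝓡 n) x₀ with he₀
  set e₁ := extChartAt (𝓡 n) x₁ with he₁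
  rw [holmesThompsonChart_apply _ _ hB, holmesThompsonChart_apply _ _ hB]
  have himg : e₁.symm ⁻¹' B ∩ e₁.target = (e₁ ∘ e₀.symm) '' (e₀.symm ⁻¹' B ∩ e₀.target) := by
    ext z
    constructor
    · rintro ⟨hz, hzt⟩
      refine ⟨e₀ (e₁.symm z), ⟨?_, e₀.map_source (h0 hz)⟩, ?_⟩
      · rw [mem_preimage, e₀.left_inv (h0 hz)]; exact hz
      · rw [Function.comp_apply, e₀.left_inv (h0 hz), e₁.right_inv hzt]
    · rintro ⟨y, ⟨hy, hyt⟩, rfl⟩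
      refine ⟨?_, e₁.map_source (h1 hy)⟩
      rw [mem_preimage, Function.comp_apply, e₁.left_inv (h1 hy)]; exact hy
  rw [himg, lintegral_image_eq_lintegral_abs_det_fderiv_mul volume
    (measurableSet_chart_preimage x₀ hB)
    (fun y hy => (frame_eq_comp (x₁ := x₁) hy.2 (h1 hy.1)).1.hasFDerivAt.hasFDerivWithinAt)]
  · refine setLIntegral_congr_fun (measurableSet_chart_preimage x₀ hB) fun y hy => ?_
    exact (holmesThompsonDensity_change hn hβ hy.2 (h1 hy.1)).symm
  · intro y hy z hz hyz
    exact e₀.symm.injOn hy.2 hz.2 (e₁.injOn (h1 hy.1) (h1 hz.1) hyz)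

/-- On the domain of a chart the Holmes-Thompson measure is the measure given by that chart. -/
lemma holmesThompson_apply (hn : 1 ≤ n) (hβ : ∀ x : M, coNorm g x (β x) < 1) {x₀ : M}
    {B : Set M} (hB : MeasurableSet B) (h0 : B ⊆ (extChartAt (𝓡 n) x₀).source) :
    holmesThompson (randers g β) B
      = ∫⁻ y in (extChartAt (𝓡 n) x₀).symm ⁻¹' B ∩ (extChartAt (𝓡 n) x₀).target,
          holmesThompsonDensity (randers g β) x₀ y := by
  rw [← holmesThompsonChart_apply _ _ hB]
  refine le_antisymm ?_ (le_iSup (fun x : M => holmesThompsonChart (randers g β) x) x₀ B)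
  set S := (extChartAt (𝓡 n) x₀).source
  have hSo : ∀ x : M, MeasurableSet (extChartAt (𝓡 n) x).source := fun x =>
    (isOpen_extChartAt_source x).measurableSet
  -- every chart measure lies below the chart measure at `x₀` plus the part off that chart
  have hle : holmesThompson (randers g β) ≤ holmesThompsonChart (randers g β) x₀ +
      (holmesThompson (randers g β)).restrict Sᶜ := by
    refine iSup_le fun x => Measure.le_iff.2 fun A hA => ?_
    have hsupp : holmesThompsonChart (randers g β) x (A ∩ S)
        = holmesThompsonChart (randers g β) x (A ∩ S ∩ (extChartAt (𝓡 n) x).source) := by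
      rw [holmesThompsonChart_apply _ _ (hA.inter (hSo x₀)),
        holmesThompsonChart_apply _ _ ((hA.inter (hSo x₀)).inter (hSo x))]
      congr 2
      ext y
      simp only [mem_inter_iff, mem_preimage]
      exact ⟨fun h => ⟨⟨h.1, mapsTo_chart_symm x h.2⟩, h.2⟩, fun h => ⟨h.1.1, h.2⟩⟩
    rw [Measure.add_apply, Measure.restrict_apply hA,
      ← measure_inter_add_sdiff A (hSo x₀)]
    refine add_le_add ?_ (le_iSup (fun x : M => holmesThompsonChart (randers g β) x) x _)
    rw [hsupp, holmesThompsonChart_eq hn hβ ((hA.inter (hSo x₀)).inter (hSo x))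
      (inter_subset_left.trans inter_subset_right) inter_subset_right]
    exact measure_mono (inter_subset_left.trans inter_subset_left)
  calc holmesThompson (randers g β) B ≤ _ := hle B
    _ = holmesThompsonChart (randers g β) x₀ B := by
      rw [Measure.add_apply, Measure.restrict_apply hB, ← sdiff_eq, sdiff_eq_empty.2 h0,
        measure_empty, add_zero]

/-- The image in `M` of the Lebesgue measure of a ball in a chart. -/
def chartBallMeasure (x₀ : M) (r : ℝ) : Measure M :=
  Measure.map (extChartAt (𝓡 n) x₀).symm
    (volume.restrict (Metric.ball (extChartAt (𝓡 n) x₀ x₀) r))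

/-- The part of `M` which corresponds to a ball in a chart. -/
def chartBall (x₀ : M) (r : ℝ) : Set M :=
  (extChartAt (𝓡 n) x₀).source ∩
    extChartAt (𝓡 n) x₀ ⁻¹' Metric.ball (extChartAt (𝓡 n) x₀ x₀) r

omit [MeasurableSpace M] [BorelSpace M] [IsManifold (𝓡 n) ∞ M] in
lemma isOpen_chartBall (x₀ : M) (r : ℝ) : IsOpen (chartBall (n := n) x₀ r) :=
  isOpen_extChartAt_preimage' x₀ Metric.isOpen_ball

omit [MeasurableSpace M] [BorelSpace M] [IsManifold (𝓡 n) ∞ M] in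
lemma mem_chartBall (x₀ : M) {r : ℝ} (hr : 0 < r) : x₀ ∈ chartBall (n := n) x₀ r :=
  ⟨mem_extChartAt_source x₀, Metric.mem_ball_self hr⟩

omit [MeasurableSpace M] [BorelSpace M] [IsManifold (𝓡 n) ∞ M] in
lemma preimage_chartBall {x₀ : M} {r : ℝ}
    (hr : Metric.closedBall (extChartAt (𝓡 n) x₀ x₀) r ⊆ (extChartAt (𝓡 n) x₀).target)
    (B : Set M) :
    (extChartAt (𝓡 n) x₀).symm ⁻¹' (B ∩ chartBall (n := n) x₀ r) ∩ (extChartAt (𝓡 n) x₀).target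
      = (extChartAt (𝓡 n) x₀).symm ⁻¹' B ∩ Metric.ball (extChartAt (𝓡 n) x₀ x₀) r := by
  ext y
  simp only [mem_inter_iff, mem_preimage, chartBall]
  constructor
  · rintro ⟨⟨hB, -, hb⟩, ht⟩
    rw [(extChartAt (𝓡 n) x₀).right_inv ht] at hb
    exact ⟨hB, hb⟩
  · rintro ⟨hB, hb⟩
    have ht := hr (Metric.ball_subset_closedBall hb)
    exact ⟨⟨hB, (extChartAt (𝓡 n) x₀).map_target ht, by
      rwa [(extChartAt (𝓡 n) x₀).right_inv ht]⟩, ht⟩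

omit [IsManifold (𝓡 n) ∞ M] in
lemma aemeasurable_chart_symm_ball {x₀ : M} {r : ℝ}
    (hr : Metric.closedBall (extChartAt (𝓡 n) x₀ x₀) r ⊆ (extChartAt (𝓡 n) x₀).target) :
    AEMeasurable (extChartAt (𝓡 n) x₀).symm
      (volume.restrict (Metric.ball (extChartAt (𝓡 n) x₀ x₀) r)) :=
  (aemeasurable_chart_symm x₀).mono_measure
    (Measure.restrict_mono (Metric.ball_subset_closedBall.trans hr) le_rfl)

/-- In a small ball of a chart the Holmes-Thompson measure is comparable to Lebesgue measure. -/
lemma holmesThompson_chartBall (hn : 1 ≤ n) (hβs : SmoothForm β)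
    (hβ : ∀ x : M, coNorm g x (β x) < 1) {x₀ : M} {r : ℝ}
    (hr : Metric.closedBall (extChartAt (𝓡 n) x₀ x₀) r ⊆ (extChartAt (𝓡 n) x₀).target) :
    ∃ a A : ℝ≥0∞, a ≠ 0 ∧ a ≠ ⊤ ∧ A ≠ ⊤ ∧
      a • chartBallMeasure (n := n) x₀ r
        ≤ (holmesThompson (randers g β)).restrict (chartBall (n := n) x₀ r) ∧
      (holmesThompson (randers g β)).restrict (chartBall (n := n) x₀ r)
        ≤ A • chartBallMeasure (n := n) x₀ r := by
  obtain ⟨a, A, ha, hA, h⟩ := holmesThompsonDensity_bounds hn hβs hβ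
    (isCompact_closedBall (extChartAt (𝓡 n) x₀ x₀) r) hr
  have key : ∀ B : Set M, MeasurableSet B →
      a * chartBallMeasure (n := n) x₀ r B
        ≤ (holmesThompson (randers g β)).restrict (chartBall (n := n) x₀ r) B ∧
      (holmesThompson (randers g β)).restrict (chartBall (n := n) x₀ r) B
        ≤ A * chartBallMeasure (n := n) x₀ r B := by
    intro B hB
    have hBm := hB.inter (isOpen_chartBall (n := n) x₀ r).measurableSet
    have hm := measurableSet_chart_preimage (n := n) x₀ hBm
    rw [Measure.restrict_apply hB, holmesThompson_apply hn hβ hBm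
      (inter_subset_right.trans inter_subset_left), chartBallMeasure,
      Measure.map_apply_of_aemeasurable (aemeasurable_chart_symm_ball hr) hB,
      Measure.restrict_apply' Metric.isOpen_ball.measurableSet]
    rw [preimage_chartBall hr] at hm ⊢
    constructor
    · rw [← setLIntegral_const]
      exact setLIntegral_mono' hm fun y hy => (h y (Metric.ball_subset_closedBall hy.2)).1
    · rw [← setLIntegral_const]
      exact setLIntegral_mono' hm fun y hy => (h y (Metric.ball_subset_closedBall hy.2)).2
  refine ⟨min a 1, A, (lt_min ha.bot_lt one_pos).ne', (min_le_right _ _).trans_lt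
    ENNReal.one_lt_top |>.ne, hA, Measure.le_iff.2 fun B hB => le_trans ?_ (key B hB).1,
    Measure.le_iff.2 fun B hB => (key B hB).2⟩
  rw [Measure.smul_apply, smul_eq_mul]
  gcongr
  exact min_le_left _ _

omit [MeasurableSpace M] [BorelSpace M] [IsManifold (𝓡 n) ∞ M] in
lemma exists_closedBall_subset_target (x₀ : M) : ∃ r : ℝ, 0 < r ∧
    Metric.closedBall (extChartAt (𝓡 n) x₀ x₀) r ⊆ (extChartAt (𝓡 n) x₀).target := by
  obtain ⟨r, hr, h⟩ := Metric.nhds_basis_closedBall.mem_iff.1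
    ((isOpen_chart_target (n := n) x₀).mem_nhds (mem_extChartAt_target x₀))
  exact ⟨r, hr, h⟩

omit [IsManifold (𝓡 n) ∞ M] in
lemma chartBallMeasure_univ_lt_top {x₀ : M} {r : ℝ}
    (hr : Metric.closedBall (extChartAt (𝓡 n) x₀ x₀) r ⊆ (extChartAt (𝓡 n) x₀).target) :
    chartBallMeasure (n := n) x₀ r univ < ⊤ := by
  rw [chartBallMeasure, Measure.map_apply_of_aemeasurable (aemeasurable_chart_symm_ball hr)
    MeasurableSet.univ, preimage_univ, Measure.restrict_apply_univ]
  exact measure_ball_lt_top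

lemma isFiniteMeasure_holmesThompson [CompactSpace M] (hn : 1 ≤ n) (hβs : SmoothForm β)
    (hβ : ∀ x : M, coNorm g x (β x) < 1) :
    IsFiniteMeasure (holmesThompson (randers g β)) := by
  choose r hr0 hr using exists_closedBall_subset_target (n := n) (M := M)
  have hfin : ∀ x, holmesThompson (randers g β) (chartBall (n := n) x (r x)) < ⊤ := by
    intro x
    obtain ⟨a, A, -, -, hA, -, h⟩ := holmesThompson_chartBall hn hβs hβ (hr x)
    rw [← Measure.restrict_apply_univ]
    exact (h univ).trans_lt (ENNReal.mul_lt_top hA.lt_top (chartBallMeasure_univ_lt_top (hr x)))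
  obtain ⟨t, ht⟩ := isCompact_univ.elim_nhds_subcover (fun x => chartBall (n := n) x (r x))
    fun x _ => (isOpen_chartBall x (r x)).mem_nhds (mem_chartBall x (hr0 x))
  refine ⟨(measure_mono ht.2).trans_lt ((measure_biUnion_finset_le t _).trans_lt ?_)⟩
  exact ENNReal.sum_lt_top.2 fun x _ => hfin x

lemma isOpenPosMeasure_holmesThompson (hn : 1 ≤ n) (hβs : SmoothForm β)
    (hβ : ∀ x : M, coNorm g x (β x) < 1) :
    (holmesThompson (randers g β)).IsOpenPosMeasure := by
  refine ⟨fun V hV hne h0 => ?_⟩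
  obtain ⟨x, hx⟩ := hne
  obtain ⟨r, hr0, hr⟩ := exists_closedBall_subset_target (n := n) x
  obtain ⟨a, A, ha, -, -, h, -⟩ := holmesThompson_chartBall hn hβs hβ hr
  have h1 : a * chartBallMeasure (n := n) x r V ≤ 0 := by
    refine (h V).trans ((Measure.restrict_apply_le _ _).trans h0.le)
  have h2 : chartBallMeasure (n := n) x r V = 0 := by
    simpa [ha] using h1
  rw [chartBallMeasure, Measure.map_apply_of_aemeasurable (aemeasurable_chart_symm_ball hr)
    hV.measurableSet, Measure.restrict_apply' Metric.isOpen_ball.measurableSet, inter_comm] at h2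
  have ho : IsOpen (Metric.ball (extChartAt (𝓡 n) x x) r ∩ (extChartAt (𝓡 n) x).symm ⁻¹' V) :=
    ((continuousOn_extChartAt_symm x).mono
      (Metric.ball_subset_closedBall.trans hr)).isOpen_inter_preimage Metric.isOpen_ball hV
  exact (ho.measure_pos volume ⟨extChartAt (𝓡 n) x x, Metric.mem_ball_self hr0, by
    rw [mem_preimage, (extChartAt (𝓡 n) x).left_inv (mem_extChartAt_source x)]; exact hx⟩).ne' h2

end Measure

/-! ### The Poincaré inequality: convex sets in Euclidean space -/

section Euclidean

variable {E : Type*} [NormedAddCommGroup E] [NormedSpace ℝ E] [FiniteDimensional ℝ E]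
  [MeasurableSpace E] [BorelSpace E] (μ : Measure E) [μ.IsAddHaarMeasure]

lemma lintegral_comp_add_smul_le {t : ℝ} (ht : 1 / 2 ≤ t) (a : E) {H : E → ℝ≥0∞}
    (hH : Measurable H) :
    ∫⁻ y, H (a + t • y) ∂μ ≤ 2 ^ Module.finrank ℝ E * ∫⁻ y, H y ∂μ := by
  have ht0 : 0 < t := by linarith
  have h1 : ∫⁻ y, H (a + t • y) ∂μ = ∫⁻ z, H (a + z) ∂(Measure.map (t • ·) μ) := by
    rw [lintegral_map (by fun_prop) (measurable_const_smul t)]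
  rw [h1, Measure.map_addHaar_smul μ ht0.ne', lintegral_smul_measure,
    lintegral_add_left_eq_self, smul_eq_mul]
  gcongr
  have h2 : |(t ^ Module.finrank ℝ E)⁻¹| ≤ 2 ^ Module.finrank ℝ E := by
    rw [abs_of_pos (by positivity), ← inv_pow]
    gcongr
    rw [inv_le_comm₀ ht0 two_pos]
    linarith
  calc ENNReal.ofReal |(t ^ Module.finrank ℝ E)⁻¹|
      ≤ ENNReal.ofReal (2 ^ Module.finrank ℝ E) := ENNReal.ofReal_le_ofReal h2
    _ = 2 ^ Module.finrank ℝ E := by rw [ENNReal.ofReal_pow zero_le_two]; simp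

/-- Averages of `H` over the points `(1 - t) x + t y`, for `x` and `y` in a set of finite measure.
One of `t` and `1 - t` is at least `1/2`, and integrating first over the variable with that
coefficient costs at most a factor `2ⁿ`. -/
lemma lintegral_lintegral_segment_le {s : Set E} {t : ℝ} {H : E → ℝ≥0∞} (hH : Measurable H) :
    ∫⁻ x in s, ∫⁻ y in s, H (x + t • (y - x)) ∂μ ∂μ
      ≤ 2 ^ Module.finrank ℝ E * μ s * ∫⁻ y, H y ∂μ := by
  have key : ∀ τ : ℝ, 1 / 2 ≤ τ → ∀ G : E → E → ℝ≥0∞, (∀ x y, G x y = H ((1 - τ) • x + τ • y)) →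
      ∫⁻ x in s, ∫⁻ y in s, G x y ∂μ ∂μ ≤ 2 ^ Module.finrank ℝ E * μ s * ∫⁻ y, H y ∂μ := by
    intro τ hτ G hG
    calc ∫⁻ x in s, ∫⁻ y in s, G x y ∂μ ∂μ
        ≤ ∫⁻ x in s, 2 ^ Module.finrank ℝ E * ∫⁻ y, H y ∂μ ∂μ := by
          refine lintegral_mono fun x => ?_
          simp only [hG]
          exact (setLIntegral_le_lintegral _ _).trans (lintegral_comp_add_smul_le μ hτ _ hH)
      _ = _ := by rw [setLIntegral_const]; ring
  rcases le_total (1 / 2) t with ht | ht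
  · exact key t ht _ fun x y => congrArg H (by module)
  · rw [lintegral_lintegral_swap (by fun_prop)]
    exact key (1 - t) (by linarith) (fun x y => H (y + t • (x - y))) fun x y =>
      congrArg H (by module)

/-- Jensen's inequality for the unit interval. -/
lemma lintegral_Icc_rpow_le {p : ℝ} (hp : 1 < p) {k : ℝ → ℝ≥0∞}
    (hk : AEMeasurable k (volume.restrict (Icc 0 1))) :
    (∫⁻ t in Icc (0 : ℝ) 1, k t) ^ p ≤ ∫⁻ t in Icc (0 : ℝ) 1, k t ^ p := by
  have h := ENNReal.lintegral_mul_le_Lp_mul_Lq (volume.restrict (Icc (0 : ℝ) 1))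
    (Real.HolderConjugate.conjExponent hp) hk (aemeasurable_const (b := (1 : ℝ≥0∞)))
  simp only [Pi.mul_apply, mul_one, ENNReal.one_rpow, lintegral_const,
    Measure.restrict_apply_univ, Real.volume_Icc, sub_zero, ENNReal.ofReal_one] at h
  calc _ ≤ ((∫⁻ t in Icc (0 : ℝ) 1, k t ^ p) ^ (1 / p)) ^ p := by gcongr
    _ = _ := by rw [← ENNReal.rpow_mul, one_div_mul_cancel (by linarith), ENNReal.rpow_one]

/-- A Poincaré inequality, in the form of a bound for the double integral of `|ψ(x) - ψ(y)|^p`. -/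
theorem lintegral_lintegral_enorm_sub_rpow_le {p : ℝ} (hp : 1 < p) {s : Set E} (hs : IsOpen s)
    (hconv : Convex ℝ s) {D : ℝ≥0∞} (hD : ∀ x ∈ s, ∀ y ∈ s, ‖y - x‖ₑ ≤ D) {ψ : E → ℝ}
    (hψ : ContDiffOn ℝ 1 ψ s) :
    ∫⁻ x in s, ∫⁻ y in s, ‖ψ x - ψ y‖ₑ ^ p ∂μ ∂μ
      ≤ D ^ p * (2 ^ Module.finrank ℝ E * μ s) * ∫⁻ y in s, ‖fderiv ℝ ψ y‖ₑ ^ p ∂μ := by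
  have hp0 : 0 ≤ p := by linarith
  set H : E → ℝ≥0∞ := s.indicator fun y => ‖fderiv ℝ ψ y‖ₑ ^ p with hHdef
  have hHm : Measurable H :=
    ((measurable_fderiv ℝ ψ).enorm.pow_const p).indicator hs.measurableSet
  have hseg : ∀ x ∈ s, ∀ y ∈ s, ∀ t ∈ Icc (0 : ℝ) 1, x + t • (y - x) ∈ s :=
    fun x hx y hy t ht => hconv.add_smul_sub_mem hx hy ht
  have hpt : ∀ x ∈ s, ∀ y ∈ s, ‖ψ x - ψ y‖ₑ ^ p
      ≤ D ^ p * ∫⁻ t in Icc (0 : ℝ) 1, H (x + t • (y - x)) := by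
    intro x hx y hy
    have hline : ContDiffOn ℝ 1 (fun t : ℝ => ψ (x + t • (y - x))) (Icc 0 1) :=
      hψ.comp (by fun_prop : ContDiff ℝ 1 fun t : ℝ => x + t • (y - x)).contDiffOn
        fun t ht => hseg x hx y hy t ht
    have h1 := enorm_sub_le_lintegral_deriv_of_contDiffOn_Icc hline zero_le_one
    simp only [one_smul, zero_smul, add_zero, add_sub_cancel] at h1
    have h2 : ∀ t ∈ Icc (0 : ℝ) 1, ‖deriv (fun t : ℝ => ψ (x + t • (y - x))) t‖ₑ
        ≤ ‖fderiv ℝ ψ (x + t • (y - x))‖ₑ * D := by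
      intro t ht
      have hd : HasFDerivAt ψ (fderiv ℝ ψ (x + t • (y - x))) (x + t • (y - x)) :=
        ((hψ.contDiffAt (hs.mem_nhds (hseg x hx y hy t ht))).differentiableAt
          one_ne_zero).hasFDerivAt
      have hl : HasDerivAt (fun t : ℝ => x + t • (y - x)) (y - x) t := by
        simpa using ((hasDerivAt_id t).smul_const (y - x)).const_add x
      have he : deriv (fun t : ℝ => ψ (x + t • (y - x))) t
          = fderiv ℝ ψ (x + t • (y - x)) (y - x) := (hd.comp_hasDerivAt t hl).deriv
      rw [he]
      refine (ContinuousLinearMap.le_opENorm _ _).trans ?_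
      gcongr
      exact hD x hx y hy
    have hm : Measurable fun t : ℝ => ‖fderiv ℝ ψ (x + t • (y - x))‖ₑ :=
      ((measurable_fderiv ℝ ψ).comp (by fun_prop : Measurable fun t : ℝ => x + t • (y - x))).enorm
    calc ‖ψ x - ψ y‖ₑ ^ p = ‖ψ y - ψ x‖ₑ ^ p := by rw [enorm_sub_rev]
      _ ≤ (∫⁻ t in Icc (0 : ℝ) 1, ‖fderiv ℝ ψ (x + t • (y - x))‖ₑ * D) ^ p := by
          gcongr
          exact h1.trans (setLIntegral_mono' measurableSet_Icc h2)
      _ ≤ ∫⁻ t in Icc (0 : ℝ) 1, (‖fderiv ℝ ψ (x + t • (y - x))‖ₑ * D) ^ p :=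
          lintegral_Icc_rpow_le hp (hm.mul_const D).aemeasurable
      _ = ∫⁻ t in Icc (0 : ℝ) 1, D ^ p * H (x + t • (y - x)) := by
          refine setLIntegral_congr_fun measurableSet_Icc fun t ht => ?_
          simp only [hHdef, indicator_of_mem (hseg x hx y hy t ht)]
          rw [ENNReal.mul_rpow_of_nonneg _ _ hp0, mul_comm]
      _ = _ := lintegral_const_mul _ (by fun_prop)
  calc ∫⁻ x in s, ∫⁻ y in s, ‖ψ x - ψ y‖ₑ ^ p ∂μ ∂μ
      ≤ ∫⁻ x in s, ∫⁻ y in s, (D ^ p * ∫⁻ t in Icc (0 : ℝ) 1, H (x + t • (y - x))) ∂μ ∂μ :=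
        setLIntegral_mono' hs.measurableSet fun x hx =>
          setLIntegral_mono' hs.measurableSet fun y hy => hpt x hx y hy
    _ = D ^ p * ∫⁻ x in s, ∫⁻ y in s, (∫⁻ t in Icc (0 : ℝ) 1, H (x + t • (y - x))) ∂μ ∂μ := by
        rw [← lintegral_const_mul _ (by fun_prop)]
        refine lintegral_congr fun x => ?_
        rw [lintegral_const_mul _ (by fun_prop)]
    _ = D ^ p * ∫⁻ t in Icc (0 : ℝ) 1, ∫⁻ x in s, ∫⁻ y in s, H (x + t • (y - x)) ∂μ ∂μ := by
        congr 1
        calc _ = ∫⁻ x in s, (∫⁻ t in Icc (0 : ℝ) 1, ∫⁻ y in s, H (x + t • (y - x)) ∂μ) ∂μ :=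
              lintegral_congr fun x => lintegral_lintegral_swap (by fun_prop)
          _ = _ := lintegral_lintegral_swap
              (f := fun x t => ∫⁻ y in s, H (x + t • (y - x)) ∂μ)
              (Measurable.lintegral_prod_right'
                (f := fun w : (E × ℝ) × E => H (w.1.1 + w.1.2 • (w.2 - w.1.1)))
                (by fun_prop)).aemeasurable
    _ ≤ D ^ p * ∫⁻ t in Icc (0 : ℝ) 1, 2 ^ Module.finrank ℝ E * μ s * ∫⁻ y, H y ∂μ := by
        gcongr
        exact lintegral_lintegral_segment_le μ hHm
    _ = _ := by
        rw [setLIntegral_const, Real.volume_Icc, hHdef, lintegral_indicator hs.measurableSet]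
        simp only [sub_zero, ENNReal.ofReal_one, mul_one, mul_assoc]

end Euclidean

/-! ### The Poincaré inequality: from local to global -/

section LocalToGlobal

variable {X : Type*} [MeasurableSpace X] {m : Measure X} {ι : Type*}
  {u : ι → X → ℝ} {e : ι → ℝ≥0∞} {p : ℝ}

/-- The double integrals of `|uᵢ(x) - uᵢ(y)|^p` over `S ⊆ X × X` are bounded by a multiple of `eᵢ`,
uniformly in `i`. -/
def PairBound (m : Measure X) (p : ℝ) (u : ι → X → ℝ) (e : ι → ℝ≥0∞) (S : Set (X × X)) : Prop :=
  ∃ C : ℝ≥0∞, C ≠ ⊤ ∧ ∀ i, ∫⁻ z in S, ‖u i z.1 - u i z.2‖ₑ ^ p ∂(m.prod m) ≤ C * e i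

lemma PairBound.mono {S T : Set (X × X)} (h : PairBound m p u e T) (hST : S ⊆ T) :
    PairBound m p u e S := by
  obtain ⟨C, hC, hi⟩ := h
  exact ⟨C, hC, fun i => (lintegral_mono_set hST).trans (hi i)⟩

lemma PairBound.union {S T : Set (X × X)} (hS : PairBound m p u e S) (hT : PairBound m p u e T) :
    PairBound m p u e (S ∪ T) := by
  obtain ⟨C, hC, hi⟩ := hS
  obtain ⟨C', hC', hi'⟩ := hT
  refine ⟨C + C', ENNReal.add_ne_top.2 ⟨hC, hC'⟩, fun i => (lintegral_union_le _ _ _).trans ?_⟩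
  rw [add_mul]
  exact add_le_add (hi i) (hi' i)

lemma setLIntegral_pair [SFinite m] (hu : ∀ i, Measurable (u i)) (i : ι) (A B : Set X) :
    ∫⁻ z in A ×ˢ B, ‖u i z.1 - u i z.2‖ₑ ^ p ∂(m.prod m)
      = ∫⁻ x in A, ∫⁻ y in B, ‖u i x - u i y‖ₑ ^ p ∂m ∂m := by
  have := hu i
  rw [setLIntegral_prod _ (by fun_prop)]

lemma PairBound.symm [SFinite m] (hu : ∀ i, Measurable (u i)) {A B : Set X}
    (h : PairBound m p u e (A ×ˢ B)) : PairBound m p u e (B ×ˢ A) := by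
  obtain ⟨C, hC, hi⟩ := h
  refine ⟨C, hC, fun i => le_of_eq_of_le ?_ (hi i)⟩
  have := hu i
  rw [setLIntegral_pair hu, setLIntegral_pair hu, lintegral_lintegral_swap (by fun_prop)]
  simp only [enorm_sub_rev]

/-- Compare `u(x)` and `u(z)` with `u(y)` and average over `y ∈ B`. -/
lemma PairBound.trans [IsFiniteMeasure m] (hp : 1 < p) (hu : ∀ i, Measurable (u i))
    {A B C : Set X} (hAB : PairBound m p u e (A ×ˢ B)) (hBC : PairBound m p u e (B ×ˢ C))
    (hB : m B ≠ 0) : PairBound m p u e (A ×ˢ C) := by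
  obtain ⟨K₁, hK₁, h₁⟩ := hAB
  obtain ⟨K₂, hK₂, h₂⟩ := hBC.symm hu
  refine ⟨(m B)⁻¹ * (2 ^ (p - 1) * (m C * K₁ + m A * K₂)), ?_, fun i => ?_⟩
  · refine ENNReal.mul_ne_top (ENNReal.inv_ne_top.2 hB) (ENNReal.mul_ne_top ?_
      (ENNReal.add_ne_top.2 ⟨ENNReal.mul_ne_top (measure_ne_top _ _) hK₁,
        ENNReal.mul_ne_top (measure_ne_top _ _) hK₂⟩))
    exact ENNReal.rpow_ne_top_of_nonneg (by linarith) ENNReal.ofNat_ne_top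
  have hm := hu i
  set k : X → X → ℝ≥0∞ := fun x y => ‖u i x - u i y‖ₑ ^ p with hk
  have hk1 : ∀ x, Measurable (k x) := fun x => by fun_prop
  have hk2 : Measurable fun x => ∫⁻ y in B, k x y ∂m :=
    Measurable.lintegral_prod_right' (f := fun z : X × X => k z.1 z.2) (by fun_prop)
  have htri : ∀ x y z, k x z ≤ 2 ^ (p - 1) * (k x y + k z y) := by
    intro x y z
    calc k x z ≤ (‖u i x - u i y‖ₑ + ‖u i z - u i y‖ₑ) ^ p := by
          simp only [hk]
          gcongr
          calc ‖u i x - u i z‖ₑ = ‖(u i x - u i y) - (u i z - u i y)‖ₑ := by ring_nf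
            _ ≤ _ := enorm_sub_le
      _ ≤ _ := ENNReal.rpow_add_le_mul_rpow_add_rpow _ _ hp.le
  have h1 := h₁ i
  have h2 := h₂ i
  rw [setLIntegral_pair hu] at h1 h2 ⊢
  change ∫⁻ x in A, ∫⁻ y in B, k x y ∂m ∂m ≤ _ at h1
  change ∫⁻ x in C, ∫⁻ y in B, k x y ∂m ∂m ≤ _ at h2
  change ∫⁻ x in A, ∫⁻ y in C, k x y ∂m ∂m ≤ _
  have hmain : m B * ∫⁻ x in A, ∫⁻ z in C, k x z ∂m ∂m
      ≤ 2 ^ (p - 1) * (m C * ∫⁻ x in A, ∫⁻ y in B, k x y ∂m ∂m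
        + m A * ∫⁻ z in C, ∫⁻ y in B, k z y ∂m ∂m) := by
    have h2p : (2 : ℝ≥0∞) ^ (p - 1) ≠ ⊤ :=
      ENNReal.rpow_ne_top_of_nonneg (by linarith) ENNReal.ofNat_ne_top
    calc m B * ∫⁻ x in A, ∫⁻ z in C, k x z ∂m ∂m
        = ∫⁻ x in A, ∫⁻ z in C, ∫⁻ _ in B, k x z ∂m ∂m ∂m := by
          rw [← lintegral_const_mul' _ _ (measure_ne_top _ _)]
          refine lintegral_congr fun x => ?_
          rw [← lintegral_const_mul' _ _ (measure_ne_top _ _)]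
          refine lintegral_congr fun z => ?_
          rw [setLIntegral_const, mul_comm]
      _ ≤ ∫⁻ x in A, ∫⁻ z in C, ∫⁻ y in B, 2 ^ (p - 1) * (k x y + k z y) ∂m ∂m ∂m :=
          lintegral_mono fun x => lintegral_mono fun z => lintegral_mono fun y => htri x y z
      _ = ∫⁻ x in A, ∫⁻ z in C, 2 ^ (p - 1) *
            ((∫⁻ y in B, k x y ∂m) + ∫⁻ y in B, k z y ∂m) ∂m ∂m := by
          refine lintegral_congr fun x => lintegral_congr fun z => ?_
          rw [lintegral_const_mul' _ _ h2p, lintegral_add_left (hk1 x)]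
      _ = ∫⁻ x in A, 2 ^ (p - 1) * ((∫⁻ y in B, k x y ∂m) * m C
            + ∫⁻ z in C, ∫⁻ y in B, k z y ∂m ∂m) ∂m := by
          refine lintegral_congr fun x => ?_
          rw [lintegral_const_mul' _ _ h2p, lintegral_add_left measurable_const, setLIntegral_const]
      _ = _ := by
          rw [lintegral_const_mul' _ _ h2p, lintegral_add_left (hk2.mul_const _),
            setLIntegral_const, lintegral_mul_const _ hk2]
          ring
  calc ∫⁻ x in A, ∫⁻ y in C, k x y ∂m ∂m
      = (m B)⁻¹ * (m B * ∫⁻ x in A, ∫⁻ y in C, k x y ∂m ∂m) := by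
        rw [← mul_assoc, ENNReal.inv_mul_cancel hB (measure_ne_top _ _), one_mul]
    _ ≤ _ := mul_le_mul' le_rfl hmain
    _ ≤ (m B)⁻¹ * (2 ^ (p - 1) * (m C * (K₁ * e i) + m A * (K₂ * e i))) := by gcongr
    _ = _ := by ring

/-- On a compact connected space, bounds on the squares of small open sets give a bound on the whole
product: by connectedness any two points have neighbourhoods whose product is bounded, and finitely
many of those products cover. -/
theorem PairBound.of_local [TopologicalSpace X] [CompactSpace X] [ConnectedSpace X]
    [BorelSpace X] [IsFiniteMeasure m] [m.IsOpenPosMeasure] (hp : 1 < p)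
    (hu : ∀ i, Measurable (u i))
    (hloc : ∀ x : X, ∃ U : Set X, IsOpen U ∧ x ∈ U ∧ PairBound m p u e (U ×ˢ U)) :
    PairBound m p u e univ := by
  let R : X → X → Prop := fun x y => ∃ U V : Set X, IsOpen U ∧ IsOpen V ∧ x ∈ U ∧ y ∈ V ∧
    PairBound m p u e (U ×ˢ V)
  have hsymm : ∀ x y, R x y → R y x := by
    rintro x y ⟨U, V, hU, hV, hx, hy, h⟩
    exact ⟨V, U, hV, hU, hy, hx, h.symm hu⟩
  have htrans : ∀ x y z, R x y → R y z → R x z := by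
    rintro x y z ⟨U, V, hU, hV, hx, hy, h⟩ ⟨V', W, hV', hW, hy', hz, h'⟩
    refine ⟨U, W, hU, hW, hx, hz, ?_⟩
    exact PairBound.trans hp hu (h.mono (prod_mono subset_rfl (inter_subset_left (t := V'))))
      (h'.mono (prod_mono inter_subset_right subset_rfl))
      ((hV.inter hV').measure_pos m ⟨y, hy, hy'⟩).ne'
  have hR : ∀ x y, R x y := by
    intro x
    have hopen : ∀ x, IsOpen {y | R x y} := by
      intro x
      refine isOpen_iff_mem_nhds.2 fun y hy => ?_
      obtain ⟨U, hU, hyU, h⟩ := hloc y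
      filter_upwards [hU.mem_nhds hyU] with z hz
      exact htrans x y z hy ⟨U, U, hU, hU, hyU, hz, h⟩
    have hclopen : IsClopen {y | R x y} := by
      refine ⟨⟨isOpen_iff_mem_nhds.2 fun y hy => ?_⟩, hopen x⟩
      obtain ⟨U, hU, hyU, h⟩ := hloc y
      filter_upwards [hU.mem_nhds hyU] with z hz hxz
      exact hy (htrans x z y hxz ⟨U, U, hU, hU, hz, hyU, h⟩)
    obtain ⟨U, hU, hxU, h⟩ := hloc x
    have huniv := hclopen.eq_univ ⟨x, ⟨U, U, hU, hU, hxU, hxU, h⟩⟩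
    intro y
    exact huniv.ge (mem_univ y)
  refine isCompact_univ.induction_on (p := PairBound m p u e) ⟨0, by simp, by simp⟩
    (fun S T hST hT => hT.mono hST) (fun S T hS hT => hS.union hT) ?_
  rintro ⟨x, y⟩ -
  obtain ⟨U, V, hU, hV, hx, hy, h⟩ := hR x y
  exact ⟨U ×ˢ V, mem_nhdsWithin_of_mem_nhds (prod_mem_nhds (hU.mem_nhds hx) (hV.mem_nhds hy)), h⟩

/-- A bound on the full double integral gives a constant close to `uᵢ`. -/
lemma PairBound.exists_const [IsFiniteMeasure m] (hm : m ≠ 0) (hu : ∀ i, Measurable (u i))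
    (h : PairBound m p u e univ) :
    ∃ C : ℝ≥0∞, C ≠ ⊤ ∧ ∀ i, ∃ c : ℝ, ∫⁻ x, ‖u i x - c‖ₑ ^ p ∂m ≤ C * e i := by
  obtain ⟨C, hC, hi⟩ := h
  have hm' : m univ ≠ 0 := by simpa using hm
  refine ⟨(m univ)⁻¹ * C, ENNReal.mul_ne_top (ENNReal.inv_ne_top.2 hm') hC, fun i => ?_⟩
  have hmi := hu i
  have h1 := hi i
  rw [← univ_prod_univ, setLIntegral_pair hu] at h1
  simp only [Measure.restrict_univ] at h1
  obtain ⟨y, hy⟩ := exists_le_laverage (μ := m) (f := fun x => ∫⁻ y, ‖u i x - u i y‖ₑ ^ p ∂m) hm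
    (Measurable.lintegral_prod_right' (f := fun z : X × X => ‖u i z.1 - u i z.2‖ₑ ^ p)
      (by fun_prop)).aemeasurable
  refine ⟨u i y, ?_⟩
  rw [laverage_eq, ENNReal.div_eq_inv_mul] at hy
  calc ∫⁻ x, ‖u i x - u i y‖ₑ ^ p ∂m = ∫⁻ x, ‖u i y - u i x‖ₑ ^ p ∂m := by
        simp only [enorm_sub_rev]
    _ ≤ _ := hy
    _ ≤ (m univ)⁻¹ * (C * e i) := by gcongr
    _ = _ := by ring

end LocalToGlobal

/-! ### Measurability of the dual norm of a 1-form -/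

section DualSup

variable {E : Type*} [NormedAddCommGroup E] [NormedSpace ℝ E] [FiniteDimensional ℝ E]

/-- The dual norm is determined by the values on a dense family of vectors. Where `N (v i) = 0` the
vector `v i` vanishes and the quotient is `0`, which does no harm. -/
lemma IsMinkowski.dualNorm_eq_iSup {N : E → ℝ} (hN : IsMinkowski N) (α : E →L[ℝ] ℝ) {ι : Type*}
    {v : ι → E} (hv : DenseRange v) : dualNorm N α = ⨆ i, α (v i) / N (v i) := by
  have : Nonempty ι := hv.nonempty
  have hle : ∀ w, α w / N w ≤ dualNorm N α := by
    intro w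
    rcases eq_or_ne w 0 with rfl | hw
    · simpa using hN.dualNorm_nonneg α
    · exact (div_le_iff₀ (hN.pos w hw)).2 (hN.apply_le_dualNorm_mul α w)
  have hbdd : BddAbove (range fun i => α (v i) / N (v i)) :=
    ⟨_, by rintro _ ⟨i, rfl⟩; exact hle _⟩
  refine le_antisymm ?_ (ciSup_le fun i => hle _)
  rcases (hN.dualNorm_nonneg α).eq_or_lt with h0 | h0
  · have h1 : ∀ w, α w = 0 := by
      intro w
      have h2 := hN.apply_le_dualNorm_mul α w
      have h3 := hN.apply_le_dualNorm_mul α (-w)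
      rw [← h0, zero_mul] at h2 h3
      rw [map_neg] at h3
      linarith
    simp [← h0, h1]
  by_contra! hlt
  obtain ⟨w, hw1, hw⟩ := hN.exists_dualNorm_eq α
  have hw0 : w ≠ 0 := by
    rintro rfl
    rw [map_zero] at hw
    exact h0.ne hw
  have hNw := hN.pos w hw0
  have h1 : dualNorm N α ≤ α w / N w := by
    rw [le_div_iff₀ hNw, hw]
    exact mul_le_of_le_one_right h0.le hw1
  have hc : ContinuousAt (fun u => α u / N u) w :=
    α.continuous.continuousAt.div hN.continuous.continuousAt hNw.ne'
  obtain ⟨i, hi⟩ := hv.exists_mem_open isOpen_interior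
    ⟨w, mem_interior_iff_mem_nhds.2 (hc.eventually_const_lt (hlt.trans_le h1))⟩
  have hi' : (⨆ i, α (v i) / N (v i)) < α (v i) / N (v i) := by
    have hi'' := interior_subset hi
    exact hi''
  exact absurd (le_ciSup hbdd i) (not_le.2 hi')

end DualSup

section Fields

variable {n : ℕ} {M : Type*} [TopologicalSpace M] [ChartedSpace (Model n) M]
  [IsManifold (𝓡 n) ∞ M]

lemma contMDiffOn_frame (x₀ : M) (v : Model n) :
    ContMDiffOn (𝓡 n) ((𝓡 n).prod 𝓘(ℝ, Model n)) ∞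
      (fun x : M => (⟨x, frame x₀ (extChartAt (𝓡 n) x₀ x) v⟩ : TangentBundle (𝓡 n) M))
      (extChartAt (𝓡 n) x₀).source := by
  set e := trivializationAt (Model n) (TangentSpace (𝓡 n) (M := M)) x₀
  have h1 : ContMDiffOn (𝓡 n) ((𝓡 n).prod 𝓘(ℝ, Model n)) ∞
      (fun x : M => e.toOpenPartialHomeomorph.symm (x, v)) (extChartAt (𝓡 n) x₀).source := by
    refine (e.contMDiffOn_symm (IB := 𝓡 n) (n := ∞)).comp
      (contMDiff_id.prodMk contMDiff_const).contMDiffOn fun x hx => ?_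
    rw [mem_preimage, e.mem_target]
    simpa [e] using hx
  refine h1.congr fun x hx => ?_
  have hb : x ∈ e.baseSet := by simpa [e] using hx
  rw [frame_eq_symmL hx v, e.symmL_apply hb]
  exact e.mk_symm hb v

/-- There are countably many smooth vector fields whose values are dense in every tangent space:
cut off the fields with constant coefficients in finitely many charts. -/
lemma exists_dense_fields [T2Space M] [CompactSpace M] :
    ∃ (ι : Type) (_ : Countable ι)
      (X : ι → ContMDiffSection (𝓡 n) (Model n) ∞ (fun x : M => Tan n x)),
      ∀ x : M, DenseRange (fun i => (X i x : Model n)) := by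
  obtain ⟨bump⟩ : Nonempty (∀ x₀ : M, SmoothBumpFunction (𝓡 n) x₀) :=
    ⟨fun _ => Classical.arbitrary _⟩
  have hbump : ∀ x₀ : M, ∀ v : Model n, ∃ X : ContMDiffSection (𝓡 n) (Model n) ∞
      (fun x : M => Tan n x), ∀ x, (X x : Model n) =
        bump x₀ x • frame x₀ (extChartAt (𝓡 n) x₀ x) v := by
    intro x₀ v
    set f := bump x₀
    refine ⟨⟨_, ContMDiffOn.smul_section_of_tsupport (f.contMDiff.contMDiffOn)
      (isOpen_extChartAt_source (I := 𝓡 n) x₀) ?_ (contMDiffOn_frame x₀ v)⟩, fun x => rfl⟩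
    rw [extChartAt_source]
    exact f.tsupport_subset_chartAt_source
  choose X hX using hbump
  let U : M → Set M := fun x₀ => {x | bump x₀ x = 1} ∩
    (extChartAt (𝓡 n) x₀).source
  obtain ⟨t, ht⟩ := isCompact_univ.elim_nhds_subcover U fun x _ =>
    inter_mem (bump x).eventuallyEq_one (extChartAt_source_mem_nhds x)
  obtain ⟨s, hsc, hsd⟩ := TopologicalSpace.exists_countable_dense (Model n)
  obtain ⟨k, ⟨eqv⟩⟩ := Finite.exists_equiv_fin t
  have hne : s.Nonempty := hsd.nonempty
  obtain ⟨d, hd⟩ := hsc.exists_eq_range hne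
  refine ⟨Fin k × ℕ, inferInstance, fun i => X (eqv.symm i.1) (d i.2), fun x => ?_⟩
  obtain ⟨x₀, hx₀, hx1, hxs⟩ : ∃ x₀ ∈ t, x ∈ U x₀ := by simpa using ht.2 (mem_univ x)
  have hsurj : Function.Surjective (frame x₀ (extChartAt (𝓡 n) x₀ x)) :=
    LinearMap.injective_iff_surjective.1 (frame_injective ((extChartAt (𝓡 n) x₀).map_source hxs))
  refine Dense.mono ?_ (hsurj.denseRange.dense_image (ContinuousLinearMap.continuous _) hsd)
  rw [hd]
  rintro _ ⟨_, ⟨j, rfl⟩, rfl⟩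
  refine ⟨(eqv ⟨x₀, hx₀⟩, j), ?_⟩
  simp only [Equiv.symm_apply_apply]
  rw [hX, show bump x₀ x = 1 from hx1, one_smul]

variable {g : Bundle.ContMDiffRiemannianMetric (𝓡 n) ∞ (Model n) (fun x : M => Tan n x)}
  {β : ∀ x : M, Cotan n x}

lemma continuous_randers_field (hβ : SmoothForm β)
    (X : ContMDiffSection (𝓡 n) (Model n) ∞ (fun x : M => Tan n x)) :
    Continuous fun x => randers g β x (X x) := by
  have hX : Continuous fun x => (⟨x, X x⟩ : TangentBundle (𝓡 n) M) := X.contMDiff.continuous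
  have h1 : Continuous fun x : M => g.inner x (X x) (X x) := by
    have h := ContinuousOn.clm_bundle_apply₂ (E₃ := Bundle.Trivial M ℝ) (F₃ := ℝ)
      (s := univ) (b := fun x : M => x) g.contMDiff.continuous.continuousOn
      hX.continuousOn hX.continuousOn
    exact (Bundle.Trivial.homeomorphProd M ℝ).continuous.snd.comp (continuousOn_univ.1 h)
  have h2 : Continuous fun x : M => β x (X x) := by
    have h := ContinuousOn.clm_bundle_apply (E₂ := Bundle.Trivial M ℝ) (F₂ := ℝ)
      (s := univ) (b := fun x : M => x) hβ.continuous.continuousOn hX.continuousOn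
    exact (Bundle.Trivial.homeomorphProd M ℝ).continuous.snd.comp (continuousOn_univ.1 h)
  exact h1.sqrt.add h2

lemma continuous_differential_field (φ : C^∞⟮𝓡 n, M; 𝓘(ℝ, ℝ), ℝ⟯)
    (X : ContMDiffSection (𝓡 n) (Model n) ∞ (fun x : M => Tan n x)) :
    Continuous fun x => differential φ x (X x) := by
  have hX : Continuous fun x => (⟨x, X x⟩ : TangentBundle (𝓡 n) M) := X.contMDiff.continuous
  have h1 : Continuous (tangentMap (𝓡 n) 𝓘(ℝ, ℝ) φ) :=
    (φ.contMDiff.contMDiff_tangentMap (m := 0) (by simp)).continuous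
  exact ((tangentBundleModelSpaceHomeomorph 𝓘(ℝ, ℝ)).continuous.comp (h1.comp hX)).snd

end Fields

section MeasurableForms

variable {n : ℕ} {M : Type*} [TopologicalSpace M] [ChartedSpace (Model n) M]
  [IsManifold (𝓡 n) ∞ M] [MeasurableSpace M] {m : Measure M}

lemma MeasurableForm.sub {η θ : ∀ x : M, Cotan n x} (hη : MeasurableForm m η)
    (hθ : MeasurableForm m θ) : MeasurableForm m fun x => η x - θ x :=
  fun X => (hη X).sub (hθ X)

lemma MeasurableForm.smul {η : ∀ x : M, Cotan n x} (hη : MeasurableForm m η) {a : M → ℝ}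
    (ha : AEStronglyMeasurable a m) : MeasurableForm m fun x => a x • η x :=
  fun X => ha.mul (hη X)

lemma measurableForm_differential [BorelSpace M] (φ : C^∞⟮𝓡 n, M; 𝓘(ℝ, ℝ), ℝ⟯) :
    MeasurableForm m (fun x : M => differential (n := n) φ x) :=
  fun X => (continuous_differential_field φ X).aestronglyMeasurable

variable {g : Bundle.ContMDiffRiemannianMetric (𝓡 n) ∞ (Model n) (fun x : M => Tan n x)}
  {β : ∀ x : M, Cotan n x}

lemma MeasurableForm.aestronglyMeasurable_dualMetric [T2Space M] [CompactSpace M] [BorelSpace M]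
    (hβs : SmoothForm β) (hβ : ∀ x : M, coNorm g x (β x) < 1) {η : ∀ x : M, Cotan n x}
    (hη : MeasurableForm m η) :
    AEStronglyMeasurable (fun x => dualMetric (randers g β) x (η x)) m := by
  obtain ⟨ι, _, X, hX⟩ := exists_dense_fields (n := n) (M := M)
  have h : (fun x => dualMetric (randers g β) x (η x))
      = fun x => ⨆ i, η x (X i x) / randers g β x (X i x) :=
    funext fun x => (isFinsler_randers hβ x).dualNorm_eq_iSup (η x) (hX x)
  rw [h]
  refine (AEMeasurable.iSup fun i => ?_).aestronglyMeasurable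
  exact (hη (X i)).aemeasurable.div (continuous_randers_field hβs (X i)).measurable.aemeasurable

end MeasurableForms

/-! ### The Poincaré inequality on the manifold -/

section Poincare

variable {n : ℕ} {M : Type*} [TopologicalSpace M] [ChartedSpace (Model n) M]
  [IsManifold (𝓡 n) ∞ M]
  {g : Bundle.ContMDiffRiemannianMetric (𝓡 n) ∞ (Model n) (fun x : M => Tan n x)}
  {β : ∀ x : M, Cotan n x}

lemma contDiffOn_comp_chart_symm (φ : C^∞⟮𝓡 n, M; 𝓘(ℝ, ℝ), ℝ⟯) (x₀ : M) :
    ContDiffOn ℝ 1 (φ ∘ (extChartAt (𝓡 n) x₀).symm) (extChartAt (𝓡 n) x₀).target :=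
  ((φ.contMDiff.comp_contMDiffOn (contMDiffOn_extChartAt_symm (n := ∞) x₀)).contDiffOn).of_le
    (by simp)

/-- The derivative of a function in a chart is its differential on the coordinate frame. -/
lemma fderiv_comp_chart_symm (φ : C^∞⟮𝓡 n, M; 𝓘(ℝ, ℝ), ℝ⟯) {x₀ : M} {y : Model n}
    (hy : y ∈ (extChartAt (𝓡 n) x₀).target) (w : Model n) :
    fderiv ℝ (φ ∘ (extChartAt (𝓡 n) x₀).symm) y w
      = differential φ ((extChartAt (𝓡 n) x₀).symm y) (frame x₀ y w) := by
  have h := mfderiv_comp (I := 𝓘(ℝ, Model n)) (I' := 𝓡 n) (I'' := 𝓘(ℝ, ℝ)) y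
    (φ.contMDiff.mdifferentiableAt (by simp)) (mdifferentiableAt_chart_symm hy)
  rw [mfderiv_eq_fderiv] at h
  exact congrArg (fun L : Model n →L[ℝ] ℝ => L w) h

omit [IsManifold (𝓡 n) ∞ M] in
lemma abs_apply_le_mul {F : ∀ x : M, Tan n x → ℝ} (hF : IsFinsler F) {x₀ : M} {y : Model n}
    {R : ℝ} (hR : ∀ v : Model n, F ((extChartAt (𝓡 n) x₀).symm y) (frame x₀ y v) ≤ R * ‖v‖)
    (α : Cotan n ((extChartAt (𝓡 n) x₀).symm y)) (w : Model n) :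
    |α (frame x₀ y w)| ≤ R * dualMetric F _ α * ‖w‖ := by
  have key : ∀ v : Model n, α (frame x₀ y v) ≤ R * dualMetric F _ α * ‖v‖ := by
    intro v
    calc α (frame x₀ y v) ≤ dualMetric F _ α * F _ (frame x₀ y v) := hF.apply_le _ _ _
      _ ≤ dualMetric F _ α * (R * ‖v‖) :=
        mul_le_mul_of_nonneg_left (hR v) (hF.dualMetric_nonneg _ _)
      _ = _ := by ring
  refine abs_le'.2 ⟨key w, ?_⟩
  have h := key (-w)
  rw [norm_neg] at h
  refine le_of_eq_of_le ?_ h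
  have h1 : frame x₀ y (-w) = -frame x₀ y w := map_neg _ _
  have h2 : α (frame x₀ y (-w)) = α (-frame x₀ y w) := congrArg α h1
  exact (h2.trans (map_neg α _)).symm

/-- The dual norm of the differential of a smooth function is bounded. -/
lemma exists_dualMetric_differential_le [CompactSpace M] (hβs : SmoothForm β)
    (hβ : ∀ x : M, coNorm g x (β x) < 1) (φ : C^∞⟮𝓡 n, M; 𝓘(ℝ, ℝ), ℝ⟯) :
    ∃ C : ℝ, ∀ x, dualMetric (randers g β) x (differential φ x) ≤ C ∧
      dualMetric (randers g β) x (-differential φ x) ≤ C := by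
  have hF := isFinsler_randers hβ
  have hloc : ∀ x₀ : M, ∃ U ∈ 𝓝 x₀, ∃ C : ℝ, ∀ x ∈ U,
      dualMetric (randers g β) x (differential φ x) ≤ C ∧
      dualMetric (randers g β) x (-differential φ x) ≤ C := by
    intro x₀
    obtain ⟨r, hr0, hr⟩ := exists_closedBall_subset_target (n := n) x₀
    have hK := isCompact_closedBall (extChartAt (𝓡 n) x₀ x₀) r
    obtain ⟨a, A, ha, -, hN⟩ := randersNorm_pull_bounds hβs hβ hK hr
    have hc : ContinuousOn (fderiv ℝ (φ ∘ (extChartAt (𝓡 n) x₀).symm))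
        (extChartAt (𝓡 n) x₀).target :=
      (contDiffOn_comp_chart_symm φ x₀).continuousOn_fderiv_of_isOpen
        (isOpen_chart_target x₀) le_rfl
    obtain ⟨D, hD⟩ := hK.exists_bound_of_continuousOn (hc.mono hr)
    have hD0 : 0 ≤ D := (norm_nonneg _).trans (hD _ (Metric.mem_closedBall_self hr0.le))
    refine ⟨chartBall (n := n) x₀ r, (isOpen_chartBall x₀ r).mem_nhds (mem_chartBall x₀ hr0),
      D / a, ?_⟩
    rintro x ⟨hxs, hxb⟩
    have hyt := (extChartAt (𝓡 n) x₀).map_source hxs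
    obtain ⟨y, rfl, hy⟩ : ∃ y, (extChartAt (𝓡 n) x₀).symm y = x ∧ y = extChartAt (𝓡 n) x₀ x :=
      ⟨_, (extChartAt (𝓡 n) x₀).left_inv hxs, rfl⟩
    have hyb : y ∈ Metric.closedBall (extChartAt (𝓡 n) x₀ x₀) r := by
      rw [hy]; exact Metric.ball_subset_closedBall hxb
    have hsurj : Function.Surjective (frame x₀ y) :=
      LinearMap.injective_iff_surjective.1 (frame_injective (hr hyb))
    have habs : ∀ v : Tan n ((extChartAt (𝓡 n) x₀).symm y),
        |differential φ ((extChartAt (𝓡 n) x₀).symm y) v| ≤ D / a * randers g β _ v := by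
      intro v
      obtain ⟨w, rfl⟩ := hsurj v
      have h1 : |differential φ ((extChartAt (𝓡 n) x₀).symm y) (frame x₀ y w)| ≤ D * ‖w‖ := by
        rw [← fderiv_comp_chart_symm φ (hr hyb) w]
        exact (ContinuousLinearMap.le_opNorm _ w).trans
          (mul_le_mul_of_nonneg_right (hD y hyb) (norm_nonneg w))
      have h2 : a * ‖w‖ ≤ randers g β ((extChartAt (𝓡 n) x₀).symm y) (frame x₀ y w) :=
        (hN y hyb w).1
      refine h1.trans ?_
      rw [div_mul_eq_mul_div, le_div_iff₀ ha]
      calc D * ‖w‖ * a = D * (a * ‖w‖) := by ring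
        _ ≤ _ := mul_le_mul_of_nonneg_left h2 hD0
    have hC : 0 ≤ D / a := div_nonneg hD0 ha.le
    exact ⟨hF.dualMetric_le _ hC fun v => (le_abs_self _).trans (habs v),
      hF.dualMetric_le _ hC fun v => (neg_le_abs _).trans (habs v)⟩
  choose U hU C hC using hloc
  obtain ⟨t, ht⟩ := isCompact_univ.elim_nhds_subcover U fun x _ => hU x
  obtain ⟨B, hB⟩ := (t.image C).exists_le
  refine ⟨B, fun x => ?_⟩
  obtain ⟨x₀, hx₀, hx⟩ : ∃ x₀ ∈ t, x ∈ U x₀ := by simpa using ht.2 (mem_univ x)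
  have h := hB _ (Finset.mem_image_of_mem C hx₀)
  exact ⟨(hC x₀ x hx).1.trans h, (hC x₀ x hx).2.trans h⟩

variable [MeasurableSpace M] [BorelSpace M]

/-- The local form of the Poincaré inequality, in a ball of a chart. -/
lemma pairBound_chartBall [T2Space M] [CompactSpace M] (hn : 1 ≤ n) (hβs : SmoothForm β)
    (hβ : ∀ x : M, coNorm g x (β x) < 1) {p : ℝ} (hp : 1 < p) {x₀ : M} {r : ℝ}
    (hr : Metric.closedBall (extChartAt (𝓡 n) x₀ x₀) r ⊆ (extChartAt (𝓡 n) x₀).target) :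
    PairBound (holmesThompson (randers g β)) p
      (fun (φ : C^∞⟮𝓡 n, M; 𝓘(ℝ, ℝ), ℝ⟯) x => φ x)
      (fun φ => ∫⁻ x, ‖dualMetric (randers g β) x (differential φ x)‖ₑ ^ p
        ∂(holmesThompson (randers g β)))
      (chartBall (n := n) x₀ r ×ˢ chartBall (n := n) x₀ r) := by
  have hF := isFinsler_randers hβ
  have hfin := isFiniteMeasure_holmesThompson hn hβs hβ
  set m := holmesThompson (randers g β) with hm
  set e := extChartAt (𝓡 n) x₀ with he
  set s := Metric.ball (e x₀) r
  set ν := chartBallMeasure (n := n) x₀ r with hν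
  have hp0 : 0 ≤ p := by linarith
  obtain ⟨a, A, ha, hatop, hA, hlow, hup⟩ := holmesThompson_chartBall hn hβs hβ hr
  obtain ⟨b, R, -, hR, hN⟩ := randersNorm_pull_bounds (g := g) hβs hβ
    (isCompact_closedBall (e x₀) r) hr
  have hsymm := aemeasurable_chart_symm_ball hr
  have hνac : ν ≪ m := by
    refine Measure.AbsolutelyContinuous.mk fun B _ hB => ?_
    have h1 : a * ν B ≤ 0 := (hlow B).trans ((Measure.restrict_apply_le _ _).trans hB.le)
    simpa [ha] using h1
  set K := ENNReal.ofReal (2 * r) ^ p * (2 ^ Module.finrank ℝ (Model n) * volume s) with hK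
  have hKtop : K ≠ ⊤ :=
    ENNReal.mul_ne_top (ENNReal.rpow_ne_top_of_nonneg hp0 ENNReal.ofReal_ne_top)
      (ENNReal.mul_ne_top (by simp) measure_ball_lt_top.ne)
  refine ⟨A * A * (K * (ENNReal.ofReal R ^ p * a⁻¹)), ?_, fun φ => ?_⟩
  · exact ENNReal.mul_ne_top (ENNReal.mul_ne_top hA hA) (ENNReal.mul_ne_top hKtop
      (ENNReal.mul_ne_top (ENNReal.rpow_ne_top_of_nonneg hp0 ENNReal.ofReal_ne_top)
        (ENNReal.inv_ne_top.2 ha)))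
  have hφ : Measurable φ := φ.contMDiff.continuous.measurable
  rw [setLIntegral_pair (fun φ : C^∞⟮𝓡 n, M; 𝓘(ℝ, ℝ), ℝ⟯ =>
    (φ.contMDiff.continuous.measurable : Measurable fun x => φ x))]
  -- upper bound: pass to Lebesgue measure in the chart
  have h1 : ∫⁻ x in chartBall (n := n) x₀ r, ∫⁻ y in chartBall (n := n) x₀ r,
      ‖φ x - φ y‖ₑ ^ p ∂m ∂m
      ≤ A * A * ∫⁻ y in s, ∫⁻ z in s, ‖φ (e.symm y) - φ (e.symm z)‖ₑ ^ p := by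
    have hint : ∀ f : M → ℝ≥0∞, ∫⁻ x in chartBall (n := n) x₀ r, f x ∂m
        ≤ A * ∫⁻ y in s, f (e.symm y) := by
      intro f
      calc _ ≤ ∫⁻ x, f x ∂(A • ν) := lintegral_mono' hup le_rfl
        _ = A * ∫⁻ x, f x ∂ν := by rw [lintegral_smul_measure, smul_eq_mul]
        _ ≤ _ := by gcongr; exact lintegral_map_le _ _
    calc _ ≤ ∫⁻ x in chartBall (n := n) x₀ r,
            (A * ∫⁻ z in s, ‖φ x - φ (e.symm z)‖ₑ ^ p) ∂m := lintegral_mono fun x => hint _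
      _ ≤ A * ∫⁻ y in s, (A * ∫⁻ z in s, ‖φ (e.symm y) - φ (e.symm z)‖ₑ ^ p) := hint _
      _ = _ := by rw [lintegral_const_mul' _ _ hA, mul_assoc]
  -- the Euclidean inequality
  have h2 : ∫⁻ y in s, ∫⁻ z in s, ‖φ (e.symm y) - φ (e.symm z)‖ₑ ^ p
      ≤ K * ∫⁻ y in s, ‖fderiv ℝ (φ ∘ e.symm) y‖ₑ ^ p := by
    refine lintegral_lintegral_enorm_sub_rpow_le volume hp Metric.isOpen_ball (convex_ball _ _)
      (fun y hy z hz => ?_) ((contDiffOn_comp_chart_symm φ x₀).mono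
        (Metric.ball_subset_closedBall.trans hr))
    rw [← ofReal_norm]
    refine ENNReal.ofReal_le_ofReal ?_
    rw [← dist_eq_norm]
    have := dist_triangle_right z y (e x₀)
    have hy' := Metric.mem_ball.1 hy
    have hz' := Metric.mem_ball.1 hz
    linarith
  -- lower bound: return to the measure on the manifold
  have h3 : ∫⁻ y in s, ‖fderiv ℝ (φ ∘ e.symm) y‖ₑ ^ p
      ≤ ENNReal.ofReal R ^ p * a⁻¹ *
        ∫⁻ x, ‖dualMetric (randers g β) x (differential φ x)‖ₑ ^ p ∂m := by
    have hmeas : AEMeasurable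
        (fun x => ‖dualMetric (randers g β) x (differential φ x)‖ₑ ^ p) ν :=
      (((measurableForm_differential φ).aestronglyMeasurable_dualMetric hβs hβ).enorm.pow_const
        p).mono_ac hνac
    calc ∫⁻ y in s, ‖fderiv ℝ (φ ∘ e.symm) y‖ₑ ^ p
        ≤ ∫⁻ y in s, ENNReal.ofReal R ^ p *
          ‖dualMetric (randers g β) (e.symm y) (differential φ (e.symm y))‖ₑ ^ p := by
          refine setLIntegral_mono' Metric.isOpen_ball.measurableSet fun y hy => ?_
          have hyK := Metric.ball_subset_closedBall hy
          rw [← ENNReal.mul_rpow_of_nonneg _ _ hp0]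
          refine ENNReal.rpow_le_rpow ?_ hp0
          have hd0 := hF.dualMetric_nonneg (e.symm y) (differential φ (e.symm y))
          rw [← ofReal_norm, ← ofReal_norm, ← ENNReal.ofReal_mul hR.le,
            Real.norm_of_nonneg hd0]
          refine ENNReal.ofReal_le_ofReal
            (ContinuousLinearMap.opNorm_le_bound _ (mul_nonneg hR.le hd0) fun w => ?_)
          rw [fderiv_comp_chart_symm φ (hr hyK) w, Real.norm_eq_abs]
          exact abs_apply_le_mul hF (fun v => (hN y hyK v).2) _ w
      _ = ENNReal.ofReal R ^ p *
          ∫⁻ x, ‖dualMetric (randers g β) x (differential φ x)‖ₑ ^ p ∂ν := by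
          rw [lintegral_const_mul' _ _ (ENNReal.rpow_ne_top_of_nonneg hp0 ENNReal.ofReal_ne_top),
            hν, chartBallMeasure, lintegral_map' hmeas hsymm]
      _ = ENNReal.ofReal R ^ p * (a⁻¹ * (a *
          ∫⁻ x, ‖dualMetric (randers g β) x (differential φ x)‖ₑ ^ p ∂ν)) := by
          rw [← mul_assoc a⁻¹, ENNReal.inv_mul_cancel ha hatop, one_mul]
      _ ≤ _ := by
          rw [mul_assoc]
          gcongr
          calc a * ∫⁻ x, ‖dualMetric (randers g β) x (differential φ x)‖ₑ ^ p ∂ν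
              = ∫⁻ x, ‖dualMetric (randers g β) x (differential φ x)‖ₑ ^ p ∂(a • ν) := by
                rw [lintegral_smul_measure, smul_eq_mul]
            _ ≤ _ := lintegral_mono' (hlow.trans Measure.restrict_le_self) le_rfl
  calc _ ≤ _ := h1
    _ ≤ A * A * (K * (ENNReal.ofReal R ^ p * a⁻¹ *
        ∫⁻ x, ‖dualMetric (randers g β) x (differential φ x)‖ₑ ^ p ∂m)) := by
        gcongr
        exact h2.trans (by gcongr)
    _ = _ := by ring

/-- The Poincaré inequality: smooth functions are close to constants in `L^p` if their differential
is small in `L^p`. -/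
theorem exists_poincare [T2Space M] [CompactSpace M] [ConnectedSpace M] (hn : 1 ≤ n)
    (hβs : SmoothForm β) (hβ : ∀ x : M, coNorm g x (β x) < 1) {p : ℝ} (hp : 1 < p) :
    ∃ C : ℝ≥0∞, C ≠ ⊤ ∧ ∀ φ : C^∞⟮𝓡 n, M; 𝓘(ℝ, ℝ), ℝ⟯, ∃ c : ℝ,
      ∫⁻ x, ‖φ x - c‖ₑ ^ p ∂(holmesThompson (randers g β))
        ≤ C * ∫⁻ x, ‖dualMetric (randers g β) x (differential φ x)‖ₑ ^ p
          ∂(holmesThompson (randers g β)) := by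
  have hfin := isFiniteMeasure_holmesThompson hn hβs hβ
  have hpos := isOpenPosMeasure_holmesThompson hn hβs hβ
  have hm : holmesThompson (randers g β) ≠ 0 := by
    intro h0
    have := isOpen_univ.measure_pos (holmesThompson (randers g β)) univ_nonempty
    simp [h0] at this
  have hu : ∀ φ : C^∞⟮𝓡 n, M; 𝓘(ℝ, ℝ), ℝ⟯, Measurable fun x => φ x :=
    fun φ => φ.contMDiff.continuous.measurable
  refine PairBound.exists_const hm hu (PairBound.of_local hp hu fun x => ?_)
  obtain ⟨r, hr0, hr⟩ := exists_closedBall_subset_target (n := n) x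
  exact ⟨_, isOpen_chartBall x r, mem_chartBall x hr0, pairBound_chartBall hn hβs hβ hp hr⟩

end Poincare

/-! ### Signed powers -/

section SignedPow

/-- The signed power `sign(t) |t|^a`, in the form `|t|^(a - 1) t`. -/
def signedPow (a t : ℝ) : ℝ := |t| ^ (a - 1) * t

lemma signedPow_zero (a : ℝ) : signedPow a 0 = 0 := by simp [signedPow]

lemma abs_rpow_sub_one_mul {a : ℝ} (ha : 0 < a) (t : ℝ) : |t| ^ (a - 1) * |t| = |t| ^ a := by
  rcases eq_or_ne t 0 with rfl | ht
  · simp [Real.zero_rpow ha.ne']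
  · rw [← Real.rpow_add_one (abs_pos.2 ht).ne', sub_add_cancel]

lemma abs_signedPow {a : ℝ} (ha : 0 < a) (t : ℝ) : |signedPow a t| = |t| ^ a := by
  rw [signedPow, abs_mul, abs_of_nonneg (Real.rpow_nonneg (abs_nonneg t) _),
    abs_rpow_sub_one_mul ha]

lemma signedPow_mul_self {a : ℝ} (ha : 0 < a) (t : ℝ) : signedPow a t * t = |t| ^ (a + 1) := by
  rw [signedPow, mul_assoc, ← abs_mul_abs_self, ← mul_assoc, abs_rpow_sub_one_mul ha]
  rcases eq_or_ne t 0 with rfl | ht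
  · simp [Real.zero_rpow (by linarith : a + 1 ≠ 0)]
  · rw [← Real.rpow_add_one (abs_pos.2 ht).ne']

lemma signedPow_signedPow (a : ℝ) {b : ℝ} (hb : 0 < b) (t : ℝ) :
    signedPow a (signedPow b t) = signedPow (a * b) t := by
  rcases eq_or_ne t 0 with rfl | ht
  · simp [signedPow_zero]
  · have ht' := abs_pos.2 ht
    rw [signedPow, abs_signedPow hb, signedPow, signedPow, ← mul_assoc, ← Real.rpow_mul ht'.le,
      ← Real.rpow_add ht']
    ring_nf

lemma signedPow_nonneg {a t : ℝ} (ht : 0 ≤ t) : 0 ≤ signedPow a t :=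
  mul_nonneg (Real.rpow_nonneg (abs_nonneg t) _) ht

lemma signedPow_nonpos {a t : ℝ} (ht : t ≤ 0) : signedPow a t ≤ 0 :=
  mul_nonpos_of_nonneg_of_nonpos (Real.rpow_nonneg (abs_nonneg t) _) ht

lemma continuous_signedPow {a : ℝ} (ha : 0 < a) : Continuous (signedPow a) := by
  refine continuous_iff_continuousAt.2 fun t => ?_
  rcases eq_or_ne t 0 with rfl | ht
  · rw [ContinuousAt, signedPow_zero]
    refine squeeze_zero_norm (a := fun t => |t| ^ a) (fun t => (abs_signedPow ha t).le) ?_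
    have : Continuous fun t : ℝ => |t| ^ a := continuous_abs.rpow_const fun _ => Or.inr ha.le
    simpa [Real.zero_rpow ha.ne'] using this.tendsto 0
  · exact (continuous_abs.continuousAt.rpow_const (Or.inl (abs_pos.2 ht).ne')).mul continuousAt_id

lemma hasDerivAt_signedPow {r : ℝ} (hr : 1 < r) (t : ℝ) :
    HasDerivAt (signedPow r) (r * |t| ^ (r - 1)) t := by
  rcases lt_trichotomy t 0 with ht | rfl | ht
  · have h1 : HasDerivAt (fun s : ℝ => -((-s) ^ r)) (r * |t| ^ (r - 1)) t := by
      have := ((hasDerivAt_neg t).rpow_const (p := r) (Or.inl (neg_pos.2 ht).ne')).neg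
      refine this.congr_deriv ?_
      rw [abs_of_neg ht]; ring
    refine h1.congr_of_eventuallyEq ?_
    filter_upwards [eventually_lt_nhds ht] with s hs
    rw [signedPow, abs_of_neg hs, show (-s) ^ (r - 1) * s = -((-s) ^ (r - 1) * (-s)) by ring,
      ← Real.rpow_add_one (neg_pos.2 hs).ne', sub_add_cancel]
  · rw [abs_zero, Real.zero_rpow (by linarith), mul_zero, hasDerivAt_iff_tendsto_slope]
    have h1 : Tendsto (fun s : ℝ => |s| ^ (r - 1)) (𝓝[≠] 0) (𝓝 0) := by
      have : Continuous fun t : ℝ => |t| ^ (r - 1) :=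
        continuous_abs.rpow_const fun _ => Or.inr (by linarith)
      have h := (this.tendsto 0).mono_left (nhdsWithin_le_nhds (s := {0}ᶜ))
      simpa [Real.zero_rpow (by linarith : r - 1 ≠ 0)] using h
    refine h1.congr' ?_
    filter_upwards [self_mem_nhdsWithin] with s hs
    have hs' : s ≠ 0 := hs
    rw [slope_def_field, signedPow_zero, signedPow]
    field_simp
    simp
  · have h1 : HasDerivAt (fun s : ℝ => s ^ r) (r * |t| ^ (r - 1)) t := by
      rw [abs_of_pos ht]
      exact Real.hasDerivAt_rpow_const (Or.inl ht.ne')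
    refine h1.congr_of_eventuallyEq ?_
    filter_upwards [eventually_gt_nhds ht] with s hs
    rw [signedPow, abs_of_pos hs, ← Real.rpow_add_one hs.ne', sub_add_cancel]

/-- The tangent line inequality for the convex function `|t|^p`, as a consequence of Young's
inequality. -/
lemma abs_rpow_sub_le {p : ℝ} (hp : 1 < p) (a c : ℝ) :
    |a| ^ p - p * c * signedPow (p - 1) a ≤ |a - c| ^ p := by
  have hp1 : 0 < p - 1 := by linarith
  have h1 : signedPow (p - 1) a * a = |a| ^ p := by
    rw [signedPow_mul_self hp1, sub_add_cancel]
  have h2 : signedPow (p - 1) a * (a - c) ≤ |a| ^ (p - 1) * |a - c| := by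
    rw [← abs_signedPow hp1, ← abs_mul]
    exact le_abs_self _
  have hconj := (Real.HolderConjugate.conjExponent hp).symm
  have h3 := Real.young_inequality_of_nonneg (Real.rpow_nonneg (abs_nonneg a) (p - 1))
    (abs_nonneg (a - c)) hconj
  rw [← Real.rpow_mul (abs_nonneg a), Real.conjExponent, mul_div_cancel₀ _ hp1.ne'] at h3
  have h4 : |a| ^ (p - 1) * |a - c| ≤ |a| ^ p * (p - 1) / p + |a - c| ^ p / p := by
    refine h3.trans_eq ?_
    rw [div_div_eq_mul_div]
  have h5 : p * (|a| ^ (p - 1) * |a - c|) ≤ |a| ^ p * (p - 1) + |a - c| ^ p := by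
    calc _ ≤ p * (|a| ^ p * (p - 1) / p + |a - c| ^ p / p) := by gcongr
      _ = _ := by field_simp
  nlinarith

end SignedPow

/-! ### Norms and means in `L^p` -/

section Lp

variable {X : Type*} [MeasurableSpace X] {m : Measure X} {p : ℝ}

lemma eLpNorm_eq_ofReal_integral (hp : 1 < p) {f : X → ℝ} (hf : MemLp f (ENNReal.ofReal p) m) :
    eLpNorm f (ENNReal.ofReal p) m = ENNReal.ofReal ((∫ x, |f x| ^ p ∂m) ^ (1 / p)) := by
  have hp0 : 0 < p := by linarith
  rw [hf.eLpNorm_eq_integral_rpow_norm (by simpa using hp0) ENNReal.ofReal_ne_top,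
    ENNReal.toReal_ofReal hp0.le, one_div]
  rfl

lemma integral_abs_rpow_nonneg (f : X → ℝ) : 0 ≤ ∫ x, |f x| ^ p ∂m :=
  integral_nonneg fun x => Real.rpow_nonneg (abs_nonneg (f x)) p

lemma integrable_abs_rpow (hp : 1 < p) {f : X → ℝ} (hf : MemLp f (ENNReal.ofReal p) m) :
    Integrable (fun x => |f x| ^ p) m := by
  have hp0 : 0 < p := by linarith
  have h := hf.integrable_norm_rpow (by simpa using hp0) ENNReal.ofReal_ne_top
  rwa [ENNReal.toReal_ofReal hp0.le] at h

lemma integral_abs_rpow_pos (hp : 1 < p) {f : X → ℝ} (hf : MemLp f (ENNReal.ofReal p) m)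
    (h0 : ¬ f =ᵐ[m] 0) : 0 < ∫ x, |f x| ^ p ∂m := by
  have hp0 : 0 < p := by linarith
  refine (integral_abs_rpow_nonneg f).lt_of_ne fun h => h0 ?_
  have h1 := (integral_eq_zero_iff_of_nonneg
    (fun x => Real.rpow_nonneg (abs_nonneg (f x)) p) (integrable_abs_rpow hp hf)).1 h.symm
  filter_upwards [h1] with x hx
  have hx' : |f x| ^ p = 0 := hx
  rw [Real.rpow_eq_zero (abs_nonneg _) hp0.ne'] at hx'
  exact abs_eq_zero.1 hx'

/-- A function with `∫ |f|^(p-2) f = 0` has minimal `L^p` norm among its translates by constants. -/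
lemma eLpNorm_le_eLpNorm_sub_const [IsFiniteMeasure m] (hp : 1 < p) {f : X → ℝ}
    (hf : MemLp f (ENNReal.ofReal p) m) (h0 : ∫ x, signedPow (p - 1) (f x) ∂m = 0) (c : ℝ) :
    eLpNorm f (ENNReal.ofReal p) m ≤ eLpNorm (fun x => f x - c) (ENNReal.ofReal p) m := by
  have hp1 : 0 < p - 1 := by linarith
  have hfc : MemLp (fun x => f x - c) (ENNReal.ofReal p) m := hf.sub (memLp_const c)
  rw [eLpNorm_eq_ofReal_integral hp hf, eLpNorm_eq_ofReal_integral hp hfc]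
  refine ENNReal.ofReal_le_ofReal (Real.rpow_le_rpow (integral_abs_rpow_nonneg f) ?_
    (by positivity))
  have hint : Integrable (fun x => signedPow (p - 1) (f x)) m := by
    refine Integrable.mono' ((integrable_abs_rpow hp hf).add (integrable_const 1))
      ((continuous_signedPow hp1).comp_aestronglyMeasurable hf.1) (ae_of_all _ fun x => ?_)
    rw [Real.norm_eq_abs, abs_signedPow hp1]
    simp only [Pi.add_apply]
    rcases le_total |f x| 1 with h | h
    · have := Real.rpow_le_one (abs_nonneg (f x)) h hp1.le
      have := Real.rpow_nonneg (abs_nonneg (f x)) p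
      linarith
    · have := Real.rpow_le_rpow_of_exponent_le h (by linarith : p - 1 ≤ p)
      linarith
  calc ∫ x, |f x| ^ p ∂m
      = ∫ x, (|f x| ^ p - p * c * signedPow (p - 1) (f x)) ∂m := by
        rw [integral_sub (integrable_abs_rpow hp hf) (hint.const_mul _), integral_const_mul, h0,
          mul_zero, sub_zero]
    _ ≤ _ := integral_mono ((integrable_abs_rpow hp hf).sub (hint.const_mul _))
        (integrable_abs_rpow hp hfc) fun x => abs_rpow_sub_le hp _ _

lemma tendsto_eLpNorm_zero_of_le [IsFiniteMeasure m] {f : ℕ → X → ℝ} {b : ℕ → ℝ}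
    (hb : Tendsto b atTop (𝓝 0)) (h : ∀ k x, |f k x| ≤ b k) :
    Tendsto (fun k => eLpNorm (f k) (ENNReal.ofReal p) m) atTop (𝓝 0) := by
  have h1 : Tendsto (fun k => m univ ^ (ENNReal.ofReal p).toReal⁻¹ * ENNReal.ofReal (b k)) atTop
      (𝓝 0) := by
    have h2 := ENNReal.Tendsto.const_mul (a := m univ ^ (ENNReal.ofReal p).toReal⁻¹)
      (ENNReal.tendsto_ofReal hb) (Or.inr
        (ENNReal.rpow_ne_top_of_nonneg (by positivity) (measure_ne_top _ _)))
    simpa using h2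
  exact tendsto_of_tendsto_of_tendsto_of_le_of_le tendsto_const_nhds h1 (fun k => zero_le)
    fun k => eLpNorm_le_of_ae_bound (ae_of_all _ fun x => h k x)

/-- Every continuous function can be translated so that a given signed power of it has mean zero. -/
lemma exists_integral_signedPow_sub_eq_zero [TopologicalSpace X] [CompactSpace X] [Nonempty X]
    [OpensMeasurableSpace X] [IsFiniteMeasure m] {a : ℝ} (ha : 0 < a) {u : X → ℝ}
    (hu : Continuous u) : ∃ c : ℝ, ∫ x, signedPow a (u x - c) ∂m = 0 := by
  have hcont : Continuous fun c : ℝ => ∫ x, signedPow a (u x - c) ∂m := by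
    have h := continuous_parametric_integral_of_continuous (μ := m)
      (f := fun (c : ℝ) (x : X) => signedPow a (u x - c)) (s := univ)
      ((continuous_signedPow ha).comp ((hu.comp continuous_snd).sub continuous_fst)) isCompact_univ
    simpa using h
  obtain ⟨x, -, hx⟩ := isCompact_univ.exists_isMinOn univ_nonempty hu.continuousOn
  obtain ⟨z, -, hz⟩ := isCompact_univ.exists_isMaxOn univ_nonempty hu.continuousOn
  have h1 : ∫ w, signedPow a (u w - u z) ∂m ≤ 0 :=
    integral_nonpos fun w => signedPow_nonpos (sub_nonpos.2 (hz (mem_univ w)))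
  have h2 : 0 ≤ ∫ w, signedPow a (u w - u x) ∂m :=
    integral_nonneg fun w => signedPow_nonneg (sub_nonneg.2 (hx (mem_univ w)))
  exact intermediate_value_univ (u z) (u x) hcont ⟨h1, h2⟩

end Lp

/-! ### Sobolev functions -/

section Sobolev

variable {n : ℕ} {M : Type*} [TopologicalSpace M] [ChartedSpace (Model n) M]
  [IsManifold (𝓡 n) ∞ M] [MeasurableSpace M]

/-- The properties of a Finsler metric and a measure on which the comparison of eigenvalues rests:
dual norms of measurable 1-forms are measurable, and those of differentials of smooth functions are
bounded. -/
structure IsTame (F : ∀ x : M, Tan n x → ℝ) (m : Measure M) : Prop where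
  isFinsler : IsFinsler F
  isFiniteMeasure : IsFiniteMeasure m
  aestronglyMeasurable : ∀ {η : ∀ x : M, Cotan n x}, MeasurableForm m η →
    AEStronglyMeasurable (fun x => dualMetric F x (η x)) m
  bounded : ∀ φ : C^∞⟮𝓡 n, M; 𝓘(ℝ, ℝ), ℝ⟯, ∃ C : ℝ, ∀ x,
    dualMetric F x (differential φ x) ≤ C ∧ dualMetric F x (-differential φ x) ≤ C

variable {F : ∀ x : M, Tan n x → ℝ} {m : Measure M} {p : ℝ}

lemma IsTame.memLp_dualMetric_differential [BorelSpace M] (h : IsTame F m)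
    (φ : C^∞⟮𝓡 n, M; 𝓘(ℝ, ℝ), ℝ⟯) (q : ℝ≥0∞) :
    MemLp (fun x => dualMetric F x (differential φ x)) q m := by
  have := h.isFiniteMeasure
  obtain ⟨C, hC⟩ := h.bounded φ
  refine MemLp.of_bound (h.aestronglyMeasurable (measurableForm_differential φ)) C
    (ae_of_all _ fun x => ?_)
  rw [Real.norm_of_nonneg (h.isFinsler.dualMetric_nonneg _ _)]
  exact (hC x).1

lemma memLp_of_continuous [CompactSpace M] [BorelSpace M] [IsFiniteMeasure m] {u : M → ℝ}
    (hu : Continuous u) (q : ℝ≥0∞) : MemLp u q m := by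
  obtain ⟨C, hC⟩ := isCompact_univ.exists_bound_of_continuousOn hu.continuousOn
  exact MemLp.of_bound hu.aestronglyMeasurable C (ae_of_all _ fun x => hC x (mem_univ x))

omit [IsManifold (𝓡 n) ∞ M] [MeasurableSpace M] in
lemma differential_comp (u : C^∞⟮𝓡 n, M; 𝓘(ℝ, ℝ), ℝ⟯) {Ψ : ℝ → ℝ} {d : ℝ} {x : M}
    (hΨ : HasDerivAt Ψ d (u x)) :
    differential (n := n) (Ψ ∘ u) x = d • differential u x := by
  have h1 : HasMFDerivAt (𝓡 n) 𝓘(ℝ, ℝ) u x (mfderiv (𝓡 n) 𝓘(ℝ, ℝ) u x) :=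
    (u.contMDiff.mdifferentiableAt (by simp)).hasMFDerivAt
  have h2 := (HasMFDerivAt.comp x (hΨ.hasFDerivAt.hasMFDerivAt) h1).mfderiv
  refine h2.trans ?_
  ext v
  exact mul_comm (G := ℝ) _ _

/-- The chain rule: if `u` is smooth and `Φ` is continuously differentiable, then `Φ ∘ u` is a
Sobolev function with differential `Φ'(u) du`. By the Weierstrass theorem `Φ` is a limit of
polynomials in `C¹` on the range of `u`. -/
lemma isSobolev_comp [CompactSpace M] [BorelSpace M] (h : IsTame F m) (hp : 1 < p)
    (u : C^∞⟮𝓡 n, M; 𝓘(ℝ, ℝ), ℝ⟯) {Φ Φ' : ℝ → ℝ} (hΦ' : Continuous Φ')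
    (hΦ : ∀ t, HasDerivAt Φ (Φ' t) t) :
    IsSobolev F m p (fun x => Φ (u x)) (fun x => Φ' (u x) • differential u x) := by
  have := h.isFiniteMeasure
  have hp0 : 0 < p := by linarith
  have hu : Continuous u := u.contMDiff.continuous
  have hΦc : Continuous Φ := continuous_iff_continuousAt.2 fun t => (hΦ t).continuousAt
  obtain ⟨R, hR⟩ := isCompact_univ.exists_bound_of_continuousOn hu.continuousOn
  have hRu : ∀ x, u x ∈ Icc (-R) R := fun x => abs_le.1 (hR x (mem_univ x))
  obtain ⟨C, hC⟩ := h.bounded u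
  have hpoly : ∀ k : ℕ, ∃ P : Polynomial ℝ, ∀ t ∈ Icc (-R) R,
      |P.eval t - Φ' t| < 1 / ((k : ℝ) + 1) := fun k =>
    exists_polynomial_near_of_continuousOn _ _ _ hΦ'.continuousOn _ (by positivity)
  choose P hP using hpoly
  let Ψ : ℕ → ℝ → ℝ := fun k t => Φ 0 + ∫ s in (0 : ℝ)..t, (P k).eval s
  have hΨd : ∀ k t, HasDerivAt (Ψ k) ((P k).eval t) t := fun k t =>
    ((P k).continuous.integral_hasStrictDerivAt 0 t).hasDerivAt.const_add _
  have hΨs : ∀ k, ContDiff ℝ ∞ (Ψ k) := by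
    intro k
    refine contDiff_infty_iff_deriv.2 ⟨fun t => (hΨd k t).differentiableAt, ?_⟩
    rw [show deriv (Ψ k) = fun t => (P k).eval t from funext fun t => (hΨd k t).deriv]
    simpa using (P k).contDiff_aeval (𝕜 := ℝ) ∞
  have hclose : ∀ k, ∀ t ∈ Icc (-R) R, |Ψ k t - Φ t| ≤ 1 / ((k : ℝ) + 1) * R := by
    intro k t ht
    have hR0 : -R ≤ R := ht.1.trans ht.2
    have h1 := Convex.norm_image_sub_le_of_norm_hasDerivWithin_le (s := Icc (-R) R)
      (f := fun t => Ψ k t - Φ t) (f' := fun t => (P k).eval t - Φ' t) (x := 0) (y := t)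
      (C := 1 / ((k : ℝ) + 1))
      (fun t _ => ((hΨd k t).sub (hΦ t)).hasDerivWithinAt) (fun t ht => (hP k t ht).le)
      (convex_Icc _ _) ⟨by linarith, by linarith⟩ ht
    have h2 : Ψ k 0 - Φ 0 = 0 := by simp [Ψ]
    rw [h2, sub_zero, sub_zero, Real.norm_eq_abs, Real.norm_eq_abs] at h1
    refine h1.trans ?_
    gcongr
    exact abs_le.2 ht
  have hlim : Tendsto (fun k : ℕ => 1 / ((k : ℝ) + 1)) atTop (𝓝 0) :=
    tendsto_one_div_add_atTop_nhds_zero_nat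
  have hlimC : Tendsto (fun k : ℕ => 1 / ((k : ℝ) + 1) * (C + C)) atTop (𝓝 0) := by
    simpa using hlim.mul_const (C + C)
  have hsub : ∀ (a b : ℝ) (x : M), a • differential (n := n) u x - b • differential u x =
      (a - b) • differential u x := fun a b x => (sub_smul a b (differential u x)).symm
  let φ : ℕ → C^∞⟮𝓡 n, M; 𝓘(ℝ, ℝ), ℝ⟯ := fun k =>
    ⟨Ψ k ∘ u, (hΨs k).contMDiff.comp u.contMDiff⟩
  have hd : ∀ k x, differential (φ k) x = (P k).eval (u x) • differential u x :=
    fun k x => differential_comp u (hΨd k (u x))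
  have hbound : ∀ (t : ℝ) (b : ℝ) (x : M), |t| ≤ b →
      |dualMetric F x (t • differential u x)| ≤ b * (C + C) := by
    intro t b x ht
    rw [abs_of_nonneg (h.isFinsler.dualMetric_nonneg _ _)]
    refine (h.isFinsler.dualMetric_smul_le x t _).trans ?_
    have h1 := h.isFinsler.dualMetric_nonneg x (differential u x)
    have h2 := h.isFinsler.dualMetric_nonneg x (-differential u x)
    exact mul_le_mul ht (add_le_add (hC x).1 (hC x).2) (by positivity)
      ((abs_nonneg t).trans ht)
  refine ⟨memLp_of_continuous (hΦc.comp hu) _,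
    (measurableForm_differential u).smul (hΦ'.comp hu).aestronglyMeasurable, φ, ?_, ?_, ?_⟩
  · exact tendsto_eLpNorm_zero_of_le (b := fun k : ℕ => 1 / ((k : ℝ) + 1) * R)
      (by simpa using hlim.mul_const R)
      fun k x => hclose k _ (hRu x)
  · refine tendsto_eLpNorm_zero_of_le hlimC fun k x => ?_
    rw [hd, hsub]
    exact hbound _ _ x (hP k _ (hRu x)).le
  · refine tendsto_eLpNorm_zero_of_le hlimC fun k x => ?_
    rw [hd, hsub]
    refine hbound _ _ x ?_
    rw [abs_sub_comm]
    exact (hP k _ (hRu x)).le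

end Sobolev

/-! ### Poincaré inequalities and the first eigenvalue -/

section Comparison

variable {n : ℕ} {M : Type*} [TopologicalSpace M] [ChartedSpace (Model n) M]
  [IsManifold (𝓡 n) ∞ M] [MeasurableSpace M] {F : ∀ x : M, Tan n x → ℝ} {m : Measure M} {p : ℝ}

omit [IsManifold (𝓡 n) ∞ M] [MeasurableSpace M] in
lemma nontrivial_of_one_le (hn : 1 ≤ n) [Nonempty M] : Nontrivial M := by
  by_contra hM
  rw [not_nontrivial_iff_subsingleton] at hM
  obtain ⟨x⟩ := ‹Nonempty M›
  have : Nonempty (Fin n) := ⟨⟨0, hn⟩⟩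
  have hs : (chartAt (Model n) x).target = {chartAt (Model n) x x} := by
    refine Subset.antisymm (fun y hy => ?_)
      (singleton_subset_iff.2 ((chartAt (Model n) x).map_source (mem_chart_source _ x)))
    rw [mem_singleton_iff, ← (chartAt (Model n) x).right_inv hy]
    exact congrArg _ (Subsingleton.elim _ _)
  have := Module.punctured_nhds_neBot ℝ (Model n) (chartAt (Model n) x x)
  exact not_isOpen_singleton (chartAt (Model n) x x) (hs ▸ (chartAt (Model n) x).open_target)

lemma IsTame.memLp_dualMetric [BorelSpace M] (h : IsTame F m) {f : M → ℝ}
    {η : ∀ x : M, Cotan n x} (hf : IsSobolev F m p f η) :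
    MemLp (fun x => dualMetric F x (η x)) (ENNReal.ofReal p) m := by
  obtain ⟨φ, -, -, h3⟩ := hf.exists_approx
  obtain ⟨k, hk⟩ := (h3.eventually_lt_const ENNReal.zero_lt_top).exists
  have h1 : MemLp (fun x => dualMetric F x (η x - differential (φ k) x)) (ENNReal.ofReal p) m :=
    ⟨h.aestronglyMeasurable (hf.measurable_form.sub (measurableForm_differential (φ k))), hk⟩
  refine (h1.add (h.memLp_dualMetric_differential (φ k) _)).mono
    (h.aestronglyMeasurable hf.measurable_form) (ae_of_all _ fun x => ?_)
  have h2 := h.isFinsler.dualMetric_add_le x (η x - differential (φ k) x) (differential (φ k) x)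
  rw [sub_add_cancel] at h2
  rw [Real.norm_of_nonneg (h.isFinsler.dualMetric_nonneg _ _)]
  exact h2.trans (le_abs_self _)

omit [IsManifold (𝓡 n) ∞ M] in
lemma energy_eq (hF : IsFinsler F) (f : M → ℝ) (η : ∀ x : M, Cotan n x) :
    energy F m p f η = (∫ x, |dualMetric F x (η x)| ^ p ∂m) / ∫ x, |f x| ^ p ∂m := by
  simp only [energy, hF.apply_legendre, abs_of_nonneg (hF.dualMetric_nonneg _ _)]

/-- A Poincaré inequality for smooth functions extends to the Sobolev functions that are
admissible for the first eigenvalue, the norm of these being minimal among their translates. -/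
lemma IsTame.eLpNorm_le_mul [BorelSpace M] (h : IsTame F m) (hp : 1 < p) {K : ℝ}
    (hP : ∀ φ : C^∞⟮𝓡 n, M; 𝓘(ℝ, ℝ), ℝ⟯, ∃ c : ℝ,
      eLpNorm (fun x => φ x - c) (ENNReal.ofReal p) m ≤
        ENNReal.ofReal K * eLpNorm (fun x => dualMetric F x (differential φ x))
          (ENNReal.ofReal p) m)
    {f : M → ℝ} {η : ∀ x : M, Cotan n x} (hf : IsSobolev F m p f η)
    (h0 : ∫ x, signedPow (p - 1) (f x) ∂m = 0) :
    eLpNorm f (ENNReal.ofReal p) m ≤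
      ENNReal.ofReal K * eLpNorm (fun x => dualMetric F x (η x)) (ENNReal.ofReal p) m := by
  have := h.isFiniteMeasure
  have hp1 : 1 ≤ ENNReal.ofReal p := ENNReal.one_le_ofReal.2 hp.le
  obtain ⟨φ, h1, h2, -⟩ := hf.exists_approx
  set D := eLpNorm (fun x => dualMetric F x (η x)) (ENNReal.ofReal p) m with hD
  have key : ∀ k, eLpNorm f (ENNReal.ofReal p) m ≤
      ENNReal.ofReal K * (eLpNorm (fun x => dualMetric F x (differential (φ k) x - η x))
        (ENNReal.ofReal p) m + D) + eLpNorm (fun x => φ k x - f x) (ENNReal.ofReal p) m := by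
    intro k
    obtain ⟨c, hc⟩ := hP (φ k)
    have hφ : AEStronglyMeasurable (fun x => φ k x) m :=
      (φ k).contMDiff.continuous.aestronglyMeasurable
    have hφη := h.aestronglyMeasurable ((measurableForm_differential (φ k)).sub hf.measurable_form)
    calc eLpNorm f (ENNReal.ofReal p) m
        ≤ eLpNorm (fun x => f x - c) (ENNReal.ofReal p) m :=
          eLpNorm_le_eLpNorm_sub_const hp hf.memLp h0 c
      _ = eLpNorm ((fun x => φ k x - c) - fun x => φ k x - f x) (ENNReal.ofReal p) m := by
          congr 1
          ext x
          simp
      _ ≤ eLpNorm (fun x => φ k x - c) (ENNReal.ofReal p) m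
          + eLpNorm (fun x => φ k x - f x) (ENNReal.ofReal p) m :=
          eLpNorm_sub_le (hφ.sub aestronglyMeasurable_const) (hφ.sub hf.memLp.1) hp1
      _ ≤ ENNReal.ofReal K * eLpNorm (fun x => dualMetric F x (differential (φ k) x))
            (ENNReal.ofReal p) m + eLpNorm (fun x => φ k x - f x) (ENNReal.ofReal p) m := by
          gcongr
      _ ≤ _ := by
          gcongr
          refine le_trans ?_ (eLpNorm_add_le hφη (h.aestronglyMeasurable hf.measurable_form) hp1)
          refine eLpNorm_mono fun x => ?_
          have h3 := h.isFinsler.dualMetric_add_le x (differential (φ k) x - η x) (η x)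
          rw [sub_add_cancel] at h3
          rw [Real.norm_of_nonneg (h.isFinsler.dualMetric_nonneg _ _)]
          exact h3.trans (le_abs_self _)
  have h3 := (ENNReal.Tendsto.const_mul (a := ENNReal.ofReal K) (h2.add_const D)
    (Or.inr ENNReal.ofReal_ne_top)).add h1
  simpa using ge_of_tendsto' h3 key

/-- On a nontrivial manifold there are admissible functions for the first eigenvalue. -/
lemma IsTame.exists_admissible [T2Space M] [CompactSpace M] [BorelSpace M] [Nontrivial M]
    (h : IsTame F m) (hm : m.IsOpenPosMeasure) (hp : 1 < p) :
    ∃ (f : M → ℝ) (η : ∀ x : M, Cotan n x), IsSobolev F m p f η ∧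
      ¬ (f =ᵐ[m] 0) ∧ ∫ x, |f x| ^ (p - 2) * f x ∂m = 0 := by
  have := h.isFiniteMeasure
  obtain ⟨x, z, hxz⟩ := exists_pair_ne M
  obtain ⟨φ, h0, h1, -⟩ := exists_contMDiffMap_zero_one_of_isClosed (n := ⊤) (𝓡 n)
    (isClosed_singleton (x := x)) (isClosed_singleton (x := z)) (disjoint_singleton.2 hxz)
  have hφ : Continuous φ := φ.contMDiff.continuous
  obtain ⟨c, hc⟩ := exists_integral_signedPow_sub_eq_zero (m := m) (a := p - 1) (by linarith) hφ
  refine ⟨_, _, isSobolev_comp h hp φ (Φ := fun t => t - c) (Φ' := fun _ => 1) continuous_const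
    fun t => (hasDerivAt_id t).sub_const c, fun hae => ?_, ?_⟩
  · have heq := (Continuous.ae_eq_iff_eq m (hφ.sub continuous_const) continuous_zero).1 hae
    have hx : φ x - c = 0 := congrFun heq x
    have hz : φ z - c = 0 := congrFun heq z
    rw [h0 (mem_singleton x)] at hx
    rw [h1 (mem_singleton z)] at hz
    simp only [Pi.zero_apply, Pi.one_apply] at hx hz
    linarith
  · rw [← hc]
    simp only [signedPow, show p - 1 - 1 = p - 2 by ring]

/-- A Poincaré inequality with constant `K` for smooth functions bounds the first eigenvalue below
by `K^(-p)`. -/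
theorem IsTame.rpow_neg_le_firstEigenvalue [T2Space M] [CompactSpace M] [BorelSpace M]
    [Nontrivial M] (h : IsTame F m) (hm : m.IsOpenPosMeasure) (hp : 1 < p) {K : ℝ} (hK : 0 < K)
    (hP : ∀ φ : C^∞⟮𝓡 n, M; 𝓘(ℝ, ℝ), ℝ⟯, ∃ c : ℝ,
      eLpNorm (fun x => φ x - c) (ENNReal.ofReal p) m ≤
        ENNReal.ofReal K * eLpNorm (fun x => dualMetric F x (differential φ x))
          (ENNReal.ofReal p) m) :
    K ^ (-p) ≤ firstEigenvalue F m p := by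
  have hp0 : 0 < p := by linarith
  obtain ⟨f₀, η₀, h₀, h₀', h₀''⟩ := h.exists_admissible hm hp
  refine le_csInf ⟨_, f₀, η₀, h₀, h₀', h₀'', rfl⟩ ?_
  rintro _ ⟨f, η, hf, hne, hint, rfl⟩
  have h1 := h.eLpNorm_le_mul hp hP hf (by
    rw [← hint]
    simp only [signedPow, show p - 1 - 1 = p - 2 by ring])
  have hA := integral_abs_rpow_pos hp hf.memLp hne
  have hD := h.memLp_dualMetric hf
  rw [eLpNorm_eq_ofReal_integral hp hf.memLp, eLpNorm_eq_ofReal_integral hp hD,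
    ← ENNReal.ofReal_mul hK.le] at h1
  have hB : 0 ≤ ∫ x, |dualMetric F x (η x)| ^ p ∂m := integral_abs_rpow_nonneg _
  have h2 := (ENNReal.ofReal_le_ofReal_iff (by positivity)).1 h1
  have h3 := Real.rpow_le_rpow (by positivity) h2 hp0.le
  rw [Real.mul_rpow hK.le (by positivity), ← Real.rpow_mul hA.le, ← Real.rpow_mul hB,
    one_div_mul_cancel hp0.ne', Real.rpow_one, Real.rpow_one] at h3
  rw [energy_eq h.isFinsler, le_div_iff₀ hA, Real.rpow_neg hK.le, inv_mul_le_iff₀ (by positivity)]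
  exact h3

lemma IsTame.firstEigenvalue_le_energy (h : IsTame F m) {f : M → ℝ} {η : ∀ x : M, Cotan n x}
    (hf : IsSobolev F m p f η) (hne : ¬ f =ᵐ[m] 0)
    (h0 : ∫ x, signedPow (p - 1) (f x) ∂m = 0) :
    firstEigenvalue F m p ≤
      (∫ x, |dualMetric F x (η x)| ^ p ∂m) / ∫ x, |f x| ^ p ∂m := by
  rw [← energy_eq h.isFinsler]
  refine csInf_le ⟨0, ?_⟩ ⟨f, η, hf, hne, ?_, rfl⟩
  · rintro _ ⟨f', η', -, -, -, rfl⟩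
    rw [energy_eq h.isFinsler]
    exact div_nonneg (integral_abs_rpow_nonneg _) (integral_abs_rpow_nonneg _)
  · rw [← h0]
    simp only [signedPow, show p - 1 - 1 = p - 2 by ring]

/-- The first eigenvalue for the exponent `p` controls a Poincaré inequality for each larger
exponent `q`: for suitable `c` the function `|φ - c|^(q/p - 1) (φ - c)` is admissible for `p`, and
Hölder's inequality bounds its energy. -/
theorem IsTame.exists_eLpNorm_sub_const_le [CompactSpace M] [BorelSpace M] [Nonempty M]
    (h : IsTame F m) {q : ℝ} (hp : 1 < p) (hpq : p < q) (hpos : 0 < firstEigenvalue F m p)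
    (φ : C^∞⟮𝓡 n, M; 𝓘(ℝ, ℝ), ℝ⟯) :
    ∃ c : ℝ, eLpNorm (fun x => φ x - c) (ENNReal.ofReal q) m ≤
      ENNReal.ofReal (q / p * firstEigenvalue F m p ^ (-(1 / p))) *
        eLpNorm (fun x => dualMetric F x (differential φ x)) (ENNReal.ofReal q) m := by
  have := h.isFiniteMeasure
  have hp0 : 0 < p := by linarith
  have hq0 : 0 < q := by linarith
  have hq1 : 1 < q := by linarith
  have hqp : 0 < q - p := by linarith
  have hr : 1 < q / p := (one_lt_div hp0).2 hpq
  have hφ : Continuous φ := φ.contMDiff.continuous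
  set l := firstEigenvalue F m p with hl
  obtain ⟨c, hc⟩ := exists_integral_signedPow_sub_eq_zero (m := m) (a := (p - 1) * (q / p))
    (mul_pos (by linarith) (by linarith)) hφ
  refine ⟨c, ?_⟩
  have hw : MemLp (fun x => φ x - c) (ENNReal.ofReal q) m :=
    memLp_of_continuous (hφ.sub continuous_const) _
  have hD := h.memLp_dualMetric_differential φ (ENNReal.ofReal q)
  rw [eLpNorm_eq_ofReal_integral hq1 hw, eLpNorm_eq_ofReal_integral hq1 hD,
    ← ENNReal.ofReal_mul (by positivity)]
  apply ENNReal.ofReal_le_ofReal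
  have hA0 : 0 ≤ ∫ x, |φ x - c| ^ q ∂m := integral_abs_rpow_nonneg _
  have hB0 : 0 ≤ ∫ x, |dualMetric F x (differential φ x)| ^ q ∂m := integral_abs_rpow_nonneg _
  set A := ∫ x, |φ x - c| ^ q ∂m with hA
  set B := ∫ x, |dualMetric F x (differential φ x)| ^ q ∂m with hB
  rcases hA0.eq_or_lt with hA' | hA'
  · rw [← hA', Real.zero_rpow (by positivity)]
    positivity
  have hpow : ∀ x, |signedPow (q / p) (φ x - c)| ^ p = |φ x - c| ^ q := fun x => by
    rw [abs_signedPow (by positivity), ← Real.rpow_mul (abs_nonneg _), div_mul_cancel₀ _ hp0.ne']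
  have hS := isSobolev_comp h hp φ (Φ := fun t => signedPow (q / p) (t - c))
    (Φ' := fun t => q / p * |t - c| ^ (q / p - 1))
    (continuous_const.mul ((continuous_id.sub continuous_const).abs.rpow_const
      fun _ => Or.inr (by linarith)))
    fun t => (hasDerivAt_signedPow hr (t - c)).comp_sub_const t c
  have hle := h.firstEigenvalue_le_energy hS (fun hae => hA'.ne' <| by
      rw [hA, ← integral_zero M ℝ (μ := m)]
      refine integral_congr_ae ?_
      filter_upwards [hae] with x hx
      have hx' : signedPow (q / p) (φ x - c) = 0 := hx
      rw [← hpow, hx', abs_zero, Real.zero_rpow hp0.ne']) (by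
    rw [← hc]
    simp only [signedPow_signedPow _ (show (0 : ℝ) < q / p by positivity)])
  simp only [hpow] at hle
  rw [← hA, ← hl, le_div_iff₀ hA'] at hle
  have hE : ∀ x, |dualMetric F x ((q / p * |φ x - c| ^ (q / p - 1)) • differential φ x)| ^ p =
      (q / p) ^ p * (|φ x - c| ^ (q - p) * |dualMetric F x (differential φ x)| ^ p) := by
    intro x
    rw [h.isFinsler.dualMetric_smul x (by positivity), abs_mul, abs_of_nonneg (by positivity),
      Real.mul_rpow (by positivity) (abs_nonneg _), Real.mul_rpow (by positivity) (by positivity),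
      ← Real.rpow_mul (abs_nonneg _), sub_mul, div_mul_cancel₀ _ hp0.ne', one_mul, mul_assoc]
  have hconj : (q / (q - p)).HolderConjugate (q / p) := by
    rw [Real.holderConjugate_iff]
    refine ⟨(one_lt_div hqp).2 (by linarith), ?_⟩
    field_simp
    ring
  have hg : MemLp (fun x => |dualMetric F x (differential φ x)| ^ p)
      (ENNReal.ofReal (q / p)) m := by
    obtain ⟨C, hC⟩ := h.bounded φ
    refine MemLp.of_bound (((Real.continuous_rpow_const hp0.le).comp
      continuous_abs).comp_aestronglyMeasurable hD.1) (C ^ p) (ae_of_all _ fun x => ?_)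
    have h0 := h.isFinsler.dualMetric_nonneg x (differential φ x)
    rw [Real.norm_of_nonneg (by positivity), abs_of_nonneg h0]
    exact Real.rpow_le_rpow h0 (hC x).1 hp0.le
  have hH := integral_mul_le_Lp_mul_Lq_of_nonneg (μ := m) hconj
    (f := fun x => |φ x - c| ^ (q - p)) (g := fun x => |dualMetric F x (differential φ x)| ^ p)
    (ae_of_all _ fun x => by positivity) (ae_of_all _ fun x => by positivity)
    (memLp_of_continuous ((hφ.sub continuous_const).abs.rpow_const fun _ => Or.inr hqp.le) _) hg
  simp only [← Real.rpow_mul (abs_nonneg _), mul_div_cancel₀ _ hqp.ne', mul_div_cancel₀ _ hp0.ne',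
    ← hA, ← hB] at hH
  simp only [hE, integral_const_mul] at hle
  rw [one_div_div, one_div_div] at hH
  -- `l A ≤ (q/p)^p A^(1 - p/q) B^(p/q)`
  have h1 : l * A ≤ (q / p) ^ p * (A ^ ((q - p) / q) * B ^ (p / q)) :=
    hle.trans (mul_le_mul_of_nonneg_left hH (by positivity))
  have h2 : l * A ^ (p / q) ≤ (q / p) ^ p * B ^ (p / q) := by
    have hAA : A = A ^ (p / q) * A ^ ((q - p) / q) := by
      rw [← Real.rpow_add hA', ← add_div, add_sub_cancel, div_self hq0.ne', Real.rpow_one]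
    have h3 : 0 < A ^ ((q - p) / q) := Real.rpow_pos_of_pos hA' _
    refine le_of_mul_le_mul_right ?_ h3
    calc l * A ^ (p / q) * A ^ ((q - p) / q) = l * A := by rw [mul_assoc, ← hAA]
      _ ≤ _ := h1
      _ = _ := by ring
  have h3 := Real.rpow_le_rpow (by positivity) h2 (one_div_nonneg.2 hp0.le)
  have e : p / q * (1 / p) = 1 / q := by field_simp
  rw [Real.mul_rpow hpos.le (by positivity), Real.mul_rpow (by positivity) (by positivity),
    ← Real.rpow_mul hA'.le, ← Real.rpow_mul hB0, ← Real.rpow_mul (by positivity), e,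
    mul_one_div_cancel hp0.ne', Real.rpow_one] at h3
  have h4 : 0 < l ^ (1 / p) := Real.rpow_pos_of_pos hpos _
  rw [Real.rpow_neg hpos.le]
  calc A ^ (1 / q) ≤ (q / p * B ^ (1 / q)) / l ^ (1 / p) := by
        rw [le_div_iff₀ h4, mul_comm]
        exact h3
    _ = _ := by ring

/-- The sharp form of the comparison of eigenvalues: `p λ_p^(1/p)` is increasing in `p`. -/
theorem IsTame.mul_rpow_firstEigenvalue_le [T2Space M] [CompactSpace M] [BorelSpace M]
    [Nontrivial M] (h : IsTame F m) (hm : m.IsOpenPosMeasure) {q : ℝ} (hp : 1 < p) (hpq : p ≤ q)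
    (hpos : 0 < firstEigenvalue F m p) :
    p * firstEigenvalue F m p ^ (1 / p) ≤ q * firstEigenvalue F m q ^ (1 / q) := by
  rcases hpq.eq_or_lt with rfl | hpq
  · exact le_rfl
  have hp0 : 0 < p := by linarith
  have hq0 : 0 < q := by linarith
  set l := firstEigenvalue F m p with hl
  have hK : 0 < q / p * l ^ (-(1 / p)) := by positivity
  have h1 := h.rpow_neg_le_firstEigenvalue hm (hp.trans hpq) hK
    (h.exists_eLpNorm_sub_const_le hp hpq hpos)
  have h2 := Real.rpow_le_rpow (by positivity) h1 (one_div_nonneg.2 hq0.le)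
  rw [← Real.rpow_mul hK.le, neg_mul, mul_one_div_cancel hq0.ne', Real.rpow_neg_one, mul_inv,
    Real.rpow_neg hpos.le, inv_inv, inv_div] at h2
  calc p * l ^ (1 / p) = q * (p / q * l ^ (1 / p)) := by field_simp
    _ ≤ _ := by gcongr

end Comparison

/-! ### The first eigenvalue of a Randers metric -/

section Randers

variable {n : ℕ} {M : Type*} [TopologicalSpace M] [T2Space M] [CompactSpace M]
  [ChartedSpace (Model n) M] [IsManifold (𝓡 n) ∞ M] [MeasurableSpace M] [BorelSpace M]
  {g : Bundle.ContMDiffRiemannianMetric (𝓡 n) ∞ (Model n) (fun x : M => Tan n x)}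
  {β : ∀ x : M, Cotan n x}

lemma isTame_randers (hn : 1 ≤ n) (hβs : SmoothForm β) (hβ : ∀ x : M, coNorm g x (β x) < 1) :
    IsTame (randers g β) (holmesThompson (randers g β)) where
  isFinsler := isFinsler_randers hβ
  isFiniteMeasure := isFiniteMeasure_holmesThompson hn hβs hβ
  aestronglyMeasurable hη := hη.aestronglyMeasurable_dualMetric hβs hβ
  bounded := exists_dualMetric_differential_le hβs hβ

theorem firstEigenvalue_randers_pos [ConnectedSpace M] (hn : 1 ≤ n) (hβs : SmoothForm β)
    (hβ : ∀ x : M, coNorm g x (β x) < 1) {p : ℝ} (hp : 1 < p) :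
    0 < firstEigenvalue (randers g β) (holmesThompson (randers g β)) p := by
  have := nontrivial_of_one_le (M := M) hn
  have hp0 : 0 < p := by linarith
  have hp' : ENNReal.ofReal p ≠ 0 := by simpa using hp0
  obtain ⟨C, hC, hP⟩ := exists_poincare (g := g) hn hβs hβ hp
  have hCp : C ^ (1 / p) ≠ ⊤ := ENNReal.rpow_ne_top_of_nonneg (by positivity) hC
  -- The summand `1` makes the constant positive.
  have hK : 0 < (C ^ (1 / p)).toReal + 1 := by positivity
  refine (Real.rpow_pos_of_pos hK (-p)).trans_le ((isTame_randers hn hβs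
    hβ).rpow_neg_le_firstEigenvalue (isOpenPosMeasure_holmesThompson hn hβs hβ) hp hK fun φ => ?_)
  obtain ⟨c, hc⟩ := hP φ
  refine ⟨c, ?_⟩
  rw [eLpNorm_eq_lintegral_rpow_enorm_toReal hp' ENNReal.ofReal_ne_top,
    eLpNorm_eq_lintegral_rpow_enorm_toReal hp' ENNReal.ofReal_ne_top, ENNReal.toReal_ofReal hp0.le]
  calc _ ≤ (C * ∫⁻ x, ‖dualMetric (randers g β) x (differential φ x)‖ₑ ^ p
          ∂(holmesThompson (randers g β))) ^ (1 / p) :=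
        ENNReal.rpow_le_rpow hc (by positivity)
    _ = C ^ (1 / p) * (∫⁻ x, ‖dualMetric (randers g β) x (differential φ x)‖ₑ ^ p
          ∂(holmesThompson (randers g β))) ^ (1 / p) :=
        ENNReal.mul_rpow_of_nonneg _ _ (by positivity)
    _ ≤ _ := by
        gcongr
        rw [ENNReal.le_ofReal_iff_toReal_le hCp hK.le]
        linarith

end Randers

end Finsler

end

theorem mainTheorem10 {n : ℕ} (hn : 1 ≤ n) {M : Type*} [TopologicalSpace M] [T2Space M]
    [CompactSpace M] [ConnectedSpace M] [ChartedSpace (EuclideanSpace ℝ (Fin n)) M]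
    [IsManifold (𝓡 n) ∞ M] [MeasurableSpace M] [BorelSpace M]
    (g : Bundle.ContMDiffRiemannianMetric (𝓡 n) ∞ (EuclideanSpace ℝ (Fin n))
      (fun x : M => Finsler.Tan n x))
    (β : ∀ x : M, Finsler.Cotan n x) (hβ : Finsler.SmoothForm β)
    (hβ_norm : ∀ x : M, Finsler.coNorm g x (β x) < 1)
    (F : ∀ x : M, Finsler.Tan n x → ℝ) (hF : F = Finsler.randers g β)
    (p q : ℝ) (hp : 1 < p) (hpq : p ≤ q) :
    0 < Finsler.firstEigenvalue F (Finsler.holmesThompson F) p ∧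
    0 < Finsler.firstEigenvalue F (Finsler.holmesThompson F) q ∧
    ENNReal.ofReal
        (p * Finsler.firstEigenvalue F (Finsler.holmesThompson F) p ^ (1 / p) /
          (q * Finsler.firstEigenvalue F (Finsler.holmesThompson F) q ^ (1 / q))) ≤
      Finsler.concavityConstant F := by
  subst hF
  have : Nontrivial M := Finsler.nontrivial_of_one_le hn
  have hposp := Finsler.firstEigenvalue_randers_pos (g := g) hn hβ hβ_norm hp
  have hposq := Finsler.firstEigenvalue_randers_pos (g := g) hn hβ hβ_norm (hp.trans_le hpq)
  have hle := (Finsler.isTame_randers hn hβ hβ_norm).mul_rpow_firstEigenvalue_le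
    (Finsler.isOpenPosMeasure_holmesThompson hn hβ hβ_norm) hp hpq hposp
  refine ⟨hposp, hposq, le_trans ?_ (Finsler.one_le_concavityConstant hn hβ_norm)⟩
  exact ENNReal.ofReal_le_one.2 (div_le_one_of_le₀ hle
    (mul_nonneg (by linarith) (Real.rpow_nonneg hposq.le _)))
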